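/- Let $m \ge 0$ and $N \ge 1$ be integers, and let $M_N(\mathbb{C})_{sa}^m$ be the real vector space of $m$-tuples $x = (x_1,\dots,x_m)$ of self-adjoint $N \times N$ matrices, with the inner product $\langle x,y\rangle_{\mathrm{Tr}} = \sum_j \mathrm{Tr}(x_j y_j)$; let $\nabla$, $\Delta$ and $dx$ be the gradient, Laplacian and Lebesgue measure for this inner product. Put $\|x\|_2^2 = \sum_j \frac1N \mathrm{Tr}(x_j^2)$ and $Du = N \nabla u$. For $0 \le c \le C < \infty$, let $\mathcal{E}(c,C)$ be the set of functions $u : M_N(\mathbb{C})_{sa}^m \to \mathbb{R}$ such that $u(x) - \frac{c}{2}\|x\|_2^2$ is convex and $u(x) - \frac{C}{2}\|x\|_2^2$ is concave. For $t > 0$ let $\sigma_{t,N}$ be the probability measure with density proportional to $\exp(-N \sum_j \mathrm{Tr}(x_j^2)/2t)$, let $\sigma_{0,N} = \delta_0$, and define $$P_t u(x) = \int u(x+y)\, d\sigma_{t,N}(y) \quad (t \ge 0), \qquad Q_t u(x) = \inf_y \Big[ u(x+y) + \frac{1}{2t}\|y\|_2^2 \Big] \quad (t > 0).$$ For a dyadic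 rational $t \ge 0$ and all integers $\ell \ge 0$ with $2^\ell t \in \mathbb{Z}$ put $R_{t,\ell} u = (P_{2^{-\ell}} Q_{2^{-\ell}})^{2^\ell t} u$ and $R_t u(x) = \lim_{\ell\to\infty} R_{t,\ell} u(x)$; for real $t \ge 0$ let $R_t u(x)$ be the limit of $R_s u(x)$ as $s \to t$ through the dyadic rationals $s \ge 0$. **Theorem.** Let $0 \le c \le C < \infty$ and $u_0 \in \mathcal{E}(c,C)$. Then the limits that define $R_t u_0$ exist for all $t \ge 0$ (and the two definitions agree for dyadic $t$), and the function $u(x,t) = R_t u_0(x)$ is smooth on $M_N(\mathbb{C})_{sa}^m \times (0,\infty)$ and satisfies there $$\partial_t u = \frac{1}{2N} \Delta u - \frac12 \|Du\|_2^2 .$$ Moreover, for all $t \ge 0$ and all $x$, the integral defining $P_t[\exp(-N^2 u_0)](x)$ converges and $$\exp(-N^2 R_t u_0(x)) = P_t[\exp(-N^2 u_0)](x).$$ -/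

import Mathlib

noncomputable section

namespace HeatHJ

/-- The real vector space of `m`-tuples of self-adjoint complex `N × N` matrices. -/
def MatTuple (m N : ℕ) : Type := Fin m → selfAdjoint (Matrix (Fin N) (Fin N) ℂ)

variable {m N : ℕ}

instance : AddCommGroup (MatTuple m N) :=
  inferInstanceAs (AddCommGroup (Fin m → selfAdjoint (Matrix (Fin N) (Fin N) ℂ)))

instance : Module ℝ (MatTuple m N) :=
  inferInstanceAs (Module ℝ (Fin m → selfAdjoint (Matrix (Fin N) (Fin N) ℂ)))

instance : FiniteDimensional ℝ (MatTuple m N) := by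
  have h : FiniteDimensional ℝ (selfAdjoint (Matrix (Fin N) (Fin N) ℂ)) :=
    inferInstanceAs
      (FiniteDimensional ℝ (selfAdjoint.submodule ℝ (Matrix (Fin N) (Fin N) ℂ)))
  exact inferInstanceAs
    (FiniteDimensional ℝ (Fin m → selfAdjoint (Matrix (Fin N) (Fin N) ℂ)))

/-- The `j`-th matrix of the tuple `x`. -/
def MatTuple.coord (x : MatTuple m N) (j : Fin m) : Matrix (Fin N) (Fin N) ℂ :=
  (show Fin m → selfAdjoint (Matrix (Fin N) (Fin N) ℂ) from x) j

@[simp] theorem MatTuple.coord_add (x y : MatTuple m N) (j : Fin m) :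
    (x + y).coord j = x.coord j + y.coord j := rfl

@[simp] theorem MatTuple.coord_smul (r : ℝ) (x : MatTuple m N) (j : Fin m) :
    (r • x).coord j = r • x.coord j := rfl

theorem MatTuple.isHermitian_coord (x : MatTuple m N) (j : Fin m) :
    (x.coord j).conjTranspose = x.coord j :=
  selfAdjoint.mem_iff.mp
    ((show Fin m → selfAdjoint (Matrix (Fin N) (Fin N) ℂ) from x) j).2

theorem MatTuple.ext_coord {x y : MatTuple m N} (h : ∀ j, x.coord j = y.coord j) : x = y :=
  funext fun j => Subtype.ext (h j)

/-- The (non-normalized) real inner product `⟨x, y⟩_Tr = ∑ j, Tr (x_j y_j)`; the trace of the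
product of two self-adjoint matrices is real. -/
def trInner (x y : MatTuple m N) : ℝ :=
  ∑ j, (Matrix.trace (x.coord j * y.coord j)).re

theorem trace_sq_re (x : MatTuple m N) (j : Fin m) :
    (Matrix.trace (x.coord j * x.coord j)).re
      = ∑ k, ∑ l, Complex.normSq (x.coord j l k) := by
  conv_lhs => rw [← congrArg (· * x.coord j) (x.isHermitian_coord j)]
  simp only [Matrix.trace, Matrix.diag, Matrix.mul_apply, Matrix.conjTranspose_apply,
    Complex.re_sum]
  refine Finset.sum_congr rfl fun k _ => Finset.sum_congr rfl fun l _ => ?_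
  simp [Complex.normSq_apply]

/-- `⟨·, ·⟩_Tr` is an inner product on the space of tuples. -/
@[reducible] def trCore : InnerProductSpace.Core ℝ (MatTuple m N) where
  inner := trInner
  conj_inner_symm x y := by
    simp only [trInner, conj_trivial]
    exact Finset.sum_congr rfl fun j _ => by rw [Matrix.trace_mul_comm]
  re_inner_nonneg x := by
    simp only [trInner, trace_sq_re, RCLike.re_to_real]
    exact Finset.sum_nonneg fun j _ => Finset.sum_nonneg fun k _ =>
      Finset.sum_nonneg fun l _ => Complex.normSq_nonneg _
  add_left x y z := by
    simp [trInner, add_mul, Finset.sum_add_distrib]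
  smul_left x y r := by
    simp [trInner, Finset.mul_sum]
  definite x hx := by
    simp only [trInner, trace_sq_re] at hx
    have h1 := (Finset.sum_eq_zero_iff_of_nonneg (fun j _ => Finset.sum_nonneg fun k _ =>
      Finset.sum_nonneg fun l _ => Complex.normSq_nonneg _)).mp hx
    refine MatTuple.ext_coord fun j => ?_
    have h2 := (Finset.sum_eq_zero_iff_of_nonneg (fun k _ =>
      Finset.sum_nonneg fun l _ => Complex.normSq_nonneg _)).mp (h1 j (Finset.mem_univ j))
    ext l k
    have h3 := (Finset.sum_eq_zero_iff_of_nonneg (fun l _ =>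
      Complex.normSq_nonneg _)).mp (h2 k (Finset.mem_univ k))
    exact Complex.normSq_eq_zero.mp (h3 l (Finset.mem_univ l))

/-- The Euclidean norm `|x|` of the inner product `⟨·, ·⟩_Tr`. -/
instance : NormedAddCommGroup (MatTuple m N) :=
  (trCore (m := m) (N := N)).toNormedAddCommGroup

/-- `MatTuple m N` is the Euclidean space with the inner product `⟨·, ·⟩_Tr`, so Mathlib's
gradient, Laplacian and Lebesgue measure on it are those of `ℝ^(m N²)` in coordinates with
respect to an orthonormal basis for `⟨·, ·⟩_Tr`. -/
instance : InnerProductSpace ℝ (MatTuple m N) :=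
  InnerProductSpace.ofCore (trCore (m := m) (N := N)).toCore

instance : CompleteSpace (MatTuple m N) := FiniteDimensional.complete ℝ (MatTuple m N)

instance : MeasurableSpace (MatTuple m N) := borel (MatTuple m N)

instance : BorelSpace (MatTuple m N) := ⟨rfl⟩

/-- The square `‖x‖₂² = ∑ j, τ_N (x_j²)` of the normalized norm, where `τ_N = (1/N) Tr`. -/
def normTwoSq (x : MatTuple m N) : ℝ :=
  ∑ j, (1 / (N : ℝ)) * (Matrix.trace (x.coord j ^ 2)).re

/-- The normalized gradient `D u = N ∇ u`, which is the gradient of `u` with respect to the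
normalized inner product `∑ j, τ_N (x_j y_j)`. -/
def normGrad (u : MatTuple m N → ℝ) (x : MatTuple m N) : MatTuple m N :=
  (N : ℝ) • gradient u x

/-- The class `E(c, C)`: `u - (c/2) ‖x‖₂²` is convex and `u - (C/2) ‖x‖₂²` is concave. -/
def classE (m N : ℕ) (c C : ℝ) : Set (MatTuple m N → ℝ) :=
  {u | ConvexOn ℝ Set.univ (fun x => u x - (1 / 2) * c * normTwoSq x) ∧
    ConcaveOn ℝ Set.univ (fun x => u x - (1 / 2) * C * normTwoSq x)}

/-- The unnormalized density `exp (-N ∑ j, Tr (x_j²) / (2t))` of the law of `m` independent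
GUE matrices of normalized variance `t`. -/
def gueWeight (t : ℝ) (x : MatTuple m N) : ENNReal :=
  ENNReal.ofReal
    (Real.exp (-((N : ℝ) * ∑ j, (Matrix.trace (x.coord j ^ 2)).re / (2 * t))))

open Classical in
/-- The law `σ_{t,N}` of `m` independent `N × N` GUE matrices of normalized variance `t > 0`;
for `t = 0` it is the point mass at `0`. -/
def gueLaw (m N : ℕ) (t : ℝ) : MeasureTheory.Measure (MatTuple m N) :=
  if t = 0 then MeasureTheory.Measure.dirac 0
  else (∫⁻ x : MatTuple m N, gueWeight t x)⁻¹ •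
    (MeasureTheory.volume : MeasureTheory.Measure (MatTuple m N)).withDensity (gueWeight t)

/-- The heat semigroup `P_t u (x) = ∫ u (x + y) dσ_{t,N}(y)`. -/
def heatP (t : ℝ) (u : MatTuple m N → ℝ) (x : MatTuple m N) : ℝ :=
  ∫ y, u (x + y) ∂(gueLaw m N t)

open Classical in
/-- The Hopf-Lax (inf-convolution) semigroup `Q_t u (x) = inf_y [u (x + y) + ‖y‖₂² / (2t)]`
for `t > 0`, with `Q_0 u = u`. -/
def hopfLaxQ (t : ℝ) (u : MatTuple m N → ℝ) (x : MatTuple m N) : ℝ :=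
  if t = 0 then u x else ⨅ y : MatTuple m N, (u (x + y) + 1 / (2 * t) * normTwoSq y)

/-- `(P_δ Q_δ)^n u` with `δ = 2^(-ℓ)`, that is, the approximation `R_{t,ℓ} u` at the time
`t = n 2^(-ℓ)`. -/
def splitting (ℓ n : ℕ) (u : MatTuple m N → ℝ) : MatTuple m N → ℝ :=
  (fun v => heatP ((1 / 2 : ℝ) ^ ℓ) (hopfLaxQ ((1 / 2 : ℝ) ^ ℓ) v))^[n] u

/-- The nonnegative dyadic rationals. -/
def dyadics : Set ℝ := {t | ∃ n k : ℕ, t = k * (1 / 2 : ℝ) ^ n}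

/-- `R_t u (x) = lim_ℓ R_{t,ℓ} u (x)` for a nonnegative dyadic rational `t`; as soon as
`2^ℓ t` is an integer, `⌊2^ℓ t⌋₊` is this integer. -/
def dyadicR (t : ℝ) (u : MatTuple m N → ℝ) (x : MatTuple m N) : ℝ :=
  Filter.limUnder Filter.atTop (fun ℓ : ℕ => splitting ℓ ⌊2 ^ ℓ * t⌋₊ u x)

/-- `R_t u (x)` for real `t ≥ 0`: the limit of `R_s u (x)` as `s → t` through the nonnegative
dyadic rationals. -/
def semigroupR (t : ℝ) (u : MatTuple m N → ℝ) (x : MatTuple m N) : ℝ :=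
  Filter.limUnder (nhdsWithin t dyadics) (fun s : ℝ => dyadicR s u x)

end HeatHJ

end

/-!
Put `f = N² u₀` and `s = t / N`. In the Euclidean norm `‖·‖` of the trace inner product the
constants `N` disappear: `N² P_t Q_t u₀` becomes `P_s Q_s f`, where `P_s` averages over the Gaussian
measure of covariance `s` and `Q_s` is the inf-convolution with `‖·‖² / (2s)`, and the claim becomes
that `(P_s Q_s)^n f` converges to the Cole–Hopf solution `V_t f = -log (P_t exp (-f))` as `n s = t`
and `s → 0`.

The operators satisfy `P_s Q_s ≤ V_s ≤ Q_s P_s`. The left inequality is the dual form of Talagrand's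
transport inequality (`lintegral_exp_neg_le`), which is the limiting case of the Prékopa–Leindler
inequality (`prekopaLeindler_volume`). The right inequality is Jensen's inequality after a
Cameron–Martin shift. All three operators are monotone and `V` is a semigroup, so
`(P_s Q_s)^n f ≤ V_{ns} f` and
`V_{(n+1)s} f ≤ (Q_s P_s)^{n+1} f = Q_s (P_s Q_s)^n P_s f ≤ (P_s Q_s)^n f + K s`.
The last step uses `Q_s ≤ id` and the bound `P_s f ≤ f + K s`, which is where semiconcavity of `f`
enters. Since `V_t f (x)` is continuous in `t ≥ 0`, both limits in the definition of `R_t` exist and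
are given by `V` (`QuadConvex.tendsto_splitOp`). Convexity of `f` makes it bounded below by an
affine function of the norm, hence `exp (-f)` integrable against all Gaussian measures, and both
`P_s` and `Q_s` preserve the convex functions of at most quadratic growth.

For smoothness and the equation, expanding the square in the heat kernel writes `P_s exp (-f) (x)`
as an explicit factor times a Laplace transform at the point `(x / s, 1 / (2s))`. Laplace transforms
are smooth, and their derivatives are again Laplace transforms, of densities multiplied by moments
(`LaplaceIntegrable.contDiffOn`, `LaplaceIntegrable.hasDerivAt`). The equation is then an identity
between first and second moments.
-/

noncomputable section

open MeasureTheory Filter Topology Set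
open scoped ENNReal Pointwise

namespace HeatHJ

/-! ### The Prékopa–Leindler inequality -/

/-- The Brunn–Minkowski inequality for compact subsets of the line. -/
theorem volume_add_le_volume_add {K L : Set ℝ} (hK : IsCompact K) (hL : IsCompact L)
    (hK' : K.Nonempty) (hL' : L.Nonempty) :
    volume K + volume L ≤ volume (K + L) := by
  -- The translates of `K` and `L` that share the endpoint `sSup K + sInf L` overlap only there.
  have ha := hK.sSup_mem hK'
  have hb := hL.sInf_mem hL'
  set a := sSup K
  set b := sInf L
  have hinter : (b +ᵥ K) ∩ (a +ᵥ L) ⊆ {a + b} := by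
    rintro x ⟨⟨k, hk, rfl⟩, ⟨l, hl, h⟩⟩
    have h1 : k ≤ a := le_csSup hK.bddAbove hk
    have h2 : b ≤ l := csInf_le hL.bddBelow hl
    simp only [vadd_eq_add] at h ⊢
    rw [mem_singleton_iff]
    linarith
  have hunion : (b +ᵥ K) ∪ (a +ᵥ L) ⊆ K + L := by
    rintro x (⟨k, hk, rfl⟩ | ⟨l, hl, rfl⟩)
    · exact ⟨k, hk, b, hb, by simp [add_comm]⟩
    · exact ⟨a, ha, l, hl, rfl⟩
  have h0 : volume ((b +ᵥ K) ∩ (a +ᵥ L)) = 0 := measure_mono_null hinter (by simp)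
  have := measure_union_add_inter (μ := volume) (b +ᵥ K) (hL.vadd a).measurableSet
  rw [h0, add_zero, measure_vadd, measure_vadd] at this
  exact this ▸ measure_mono hunion

theorem measure_add_le_of_forall_isCompact {A : Set ℝ} (hA : MeasurableSet A)
    (hA' : A.Nonempty) {c d : ℝ≥0∞}
    (h : ∀ K ⊆ A, IsCompact K → K.Nonempty → volume K + c ≤ d) : volume A + c ≤ d := by
  obtain ⟨x, hx⟩ := hA'
  have hcd : c ≤ d := by
    simpa using h {x} (by simpa) isCompact_singleton (singleton_nonempty x)
  rcases eq_or_ne c ⊤ with rfl | hc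
  · rw [top_le_iff.mp hcd]; exact le_top
  have : volume A ≤ d - c := by
    rw [hA.measure_eq_iSup_isCompact]
    refine iSup_le fun K => iSup_le fun hKA => iSup_le fun hK => ?_
    rcases K.eq_empty_or_nonempty with rfl | hne
    · simp
    · exact ENNReal.le_sub_of_add_le_right hc (h K hKA hK hne)
  calc volume A + c ≤ d - c + c := by gcongr
    _ = d := tsub_add_cancel_of_le hcd

/-- The one-dimensional Brunn–Minkowski inequality for a set `S` that contains `a A + b B`. -/
theorem smul_volume_add_smul_volume_le {a b : ℝ} (ha : 0 < a) (hb : 0 < b) {A B S : Set ℝ}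
    (hA : MeasurableSet A) (hB : MeasurableSet B) (hA' : A.Nonempty) (hB' : B.Nonempty)
    (h : ∀ x ∈ A, ∀ y ∈ B, a * x + b * y ∈ S) :
    ENNReal.ofReal a * volume A + ENNReal.ofReal b * volume B ≤ volume S := by
  have e : ∀ {r : ℝ}, 0 < r → ∀ U : Set ℝ, ENNReal.ofReal r * volume U = volume (r • U) := by
    intro r hr U
    rw [Measure.addHaar_smul]; simp [abs_of_pos hr]
  rw [e ha, e hb]
  refine measure_add_le_of_forall_isCompact (hA.const_smul_of_ne_zero ha.ne')
    (hA'.smul_set) fun K hKA hK hK' => ?_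
  rw [add_comm]
  refine measure_add_le_of_forall_isCompact (hB.const_smul_of_ne_zero hb.ne')
    (hB'.smul_set) fun L hLB hL hL' => ?_
  rw [add_comm]
  refine (volume_add_le_volume_add hK hL hK' hL').trans (measure_mono ?_)
  rintro _ ⟨k, hk, l, hl, rfl⟩
  obtain ⟨x, hx, rfl⟩ := hKA hk
  obtain ⟨y, hy, rfl⟩ := hLB hl
  exact h x hx y hy

theorem ennreal_geom_mean_le_arith_mean {a b : ℝ} (ha : 0 < a) (hb : 0 < b) (hab : a + b = 1)
    (p q : ℝ≥0∞) : p ^ a * q ^ b ≤ ENNReal.ofReal a * p + ENNReal.ofReal b * q := by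
  rcases eq_or_ne p ⊤ with rfl | hp
  · simp [ENNReal.mul_top, ha]
  rcases eq_or_ne q ⊤ with rfl | hq
  · simp [ENNReal.mul_top, hb]
  lift p to NNReal using hp
  lift q to NNReal using hq
  lift a to NNReal using ha.le
  lift b to NNReal using hb.le
  have := NNReal.geom_mean_le_arith_mean2_weighted a b p q (by exact_mod_cast hab)
  rw [← ENNReal.coe_rpow_of_nonneg p ha.le, ← ENNReal.coe_rpow_of_nonneg q hb.le,
    ENNReal.ofReal_coe_nnreal, ENNReal.ofReal_coe_nnreal]
  exact_mod_cast this

/-- The one-dimensional Prékopa–Leindler inequality for functions with supremum `1`, by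
integrating the Brunn–Minkowski inequality over the superlevel sets. -/
theorem prekopaLeindler_real_of_iSup_eq_one {a b : ℝ} (ha : 0 < a) (hb : 0 < b) (hab : a + b = 1)
    {F G H : ℝ → ℝ≥0∞} (hF : Measurable F) (hG : Measurable G) (hH : Measurable H)
    (hF1 : ⨆ x, F x = 1) (hG1 : ⨆ x, G x = 1)
    (h : ∀ x y, F x ^ a * G y ^ b ≤ H (a * x + b * y)) :
    (∫⁻ x, F x) ^ a * (∫⁻ x, G x) ^ b ≤ ∫⁻ x, H x := by
  have key : ∀ {f : ℝ → ℝ≥0∞}, Measurable f → (∀ x, f x ≤ 1) →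
      ∫⁻ x, f x = ∫⁻ t in Ioo (0 : ℝ) 1, volume {x | ENNReal.ofReal t < f x} := by
    intro f hf hf1
    have hne : ∀ x, f x ≠ ⊤ := fun x => ((hf1 x).trans_lt ENNReal.one_lt_top).ne
    have h1 := lintegral_eq_lintegral_meas_lt (f := fun x => (f x).toReal) volume
      (Eventually.of_forall fun x => ENNReal.toReal_nonneg) hf.ennreal_toReal.aemeasurable
    simp only [ENNReal.ofReal_toReal (hne _)] at h1
    rw [h1, ← Ioo_union_Ici_eq_Ioi (zero_lt_one' ℝ), lintegral_union measurableSet_Ici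
      (by rw [Set.disjoint_left]; intro x hx hx'; exact not_lt.mpr hx' hx.2)]
    have h2 : ∫⁻ t in Ici (1 : ℝ), volume {x | t < (f x).toReal} = 0 := by
      rw [setLIntegral_congr_fun (g := fun _ => 0) measurableSet_Ici]
      · simp
      · intro t ht
        have : {x | t < (f x).toReal} = ∅ := by
          ext x
          have := ENNReal.toReal_mono ENNReal.one_ne_top (hf1 x)
          simp only [mem_ofPred_eq, mem_empty_iff_false, iff_false, not_lt]
          exact this.trans (by simpa using ht)
        simp [this]
    rw [h2, add_zero]
    refine setLIntegral_congr_fun measurableSet_Ioo fun t ht => ?_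
    simp only [ENNReal.ofReal_lt_iff_lt_toReal ht.1.le (hne _)]
  have hFle : ∀ x, F x ≤ 1 := fun x => hF1 ▸ le_iSup F x
  have hGle : ∀ x, G x ≤ 1 := fun x => hG1 ▸ le_iSup G x
  have hle : ∫⁻ x, min (H x) 1 ≤ ∫⁻ x, H x := lintegral_mono fun x => min_le_left _ _
  refine le_trans ?_ hle
  refine (ennreal_geom_mean_le_arith_mean ha hb hab _ _).trans ?_
  have hm : ∀ f : ℝ → ℝ≥0∞, Measurable fun t : ℝ => volume {x | ENNReal.ofReal t < f x} :=
    fun f => Antitone.measurable fun s t hst => measure_mono fun x hx =>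
      (ENNReal.ofReal_le_ofReal hst).trans_lt hx
  rw [key hF hFle, key hG hGle, key (hH.min measurable_const) fun x => min_le_right _ _,
    ← lintegral_const_mul _ (hm F), ← lintegral_const_mul _ (hm G),
    ← lintegral_add_left ((hm F).const_mul _)]
  refine setLIntegral_mono' measurableSet_Ioo fun t ht => ?_
  have ht1 : ENNReal.ofReal t < 1 := by simpa using ht.2
  obtain ⟨x₀, hx₀⟩ := lt_iSup_iff.mp (hF1 ▸ ht1)
  obtain ⟨y₀, hy₀⟩ := lt_iSup_iff.mp (hG1 ▸ ht1)
  refine smul_volume_add_smul_volume_le ha hb (measurableSet_lt measurable_const hF)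
    (measurableSet_lt measurable_const hG) ⟨x₀, hx₀⟩ ⟨y₀, hy₀⟩ fun x hx y hy => ?_
  refine lt_min ?_ ht1
  refine lt_of_lt_of_le ?_ (h x y)
  have ht0 : ENNReal.ofReal t ≠ 0 := by simpa using ht.1
  calc ENNReal.ofReal t = ENNReal.ofReal t ^ a * ENNReal.ofReal t ^ b := by
        rw [← ENNReal.rpow_add _ _ ht0 ENNReal.ofReal_ne_top, hab, ENNReal.rpow_one]
    _ < F x ^ a * G y ^ b := by
        refine ENNReal.mul_lt_mul (ENNReal.rpow_lt_rpow hx ha) (ENNReal.rpow_lt_rpow hy hb)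

/-- For bounded functions, divide by the suprema. -/
theorem prekopaLeindler_real_of_bounded {a b : ℝ} (ha : 0 < a) (hb : 0 < b) (hab : a + b = 1)
    {F G H : ℝ → ℝ≥0∞} (hF : Measurable F) (hG : Measurable G) (hH : Measurable H)
    (hF1 : ⨆ x, F x ≠ ⊤) (hG1 : ⨆ x, G x ≠ ⊤)
    (h : ∀ x y, F x ^ a * G y ^ b ≤ H (a * x + b * y)) :
    (∫⁻ x, F x) ^ a * (∫⁻ x, G x) ^ b ≤ ∫⁻ x, H x := by
  set α := ⨆ x, F x with hα
  set β := ⨆ x, G x with hβ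
  rcases eq_or_ne α 0 with h0 | h0
  · have : F = 0 := funext fun x => by simpa using (ENNReal.iSup_eq_zero.mp h0 x)
    simp [this, ha]
  rcases eq_or_ne β 0 with h0' | h0'
  · have : G = 0 := funext fun x => by simpa using (ENNReal.iSup_eq_zero.mp h0' x)
    simp [this, hb]
  set c := α⁻¹ ^ a * β⁻¹ ^ b with hc
  have hc0 : c ≠ 0 := by
    simp only [hc, ne_eq, mul_eq_zero, ENNReal.rpow_eq_zero_iff, ENNReal.inv_eq_zero,
      ENNReal.inv_eq_top]
    tauto
  have hct : c ≠ ⊤ := by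
    refine ENNReal.mul_ne_top (ENNReal.rpow_ne_top_of_nonneg ha.le ?_)
      (ENNReal.rpow_ne_top_of_nonneg hb.le ?_) <;> simpa
  have e : ∀ p q : ℝ≥0∞, (α⁻¹ * p) ^ a * (β⁻¹ * q) ^ b = c * (p ^ a * q ^ b) := by
    intro p q
    rw [ENNReal.mul_rpow_of_nonneg _ _ ha.le, ENNReal.mul_rpow_of_nonneg _ _ hb.le, hc]
    ring
  have := prekopaLeindler_real_of_iSup_eq_one (F := fun x => α⁻¹ * F x)
    (G := fun x => β⁻¹ * G x) (H := fun x => c * H x) ha hb hab (hF.const_mul _)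
    (hG.const_mul _) (hH.const_mul _)
    (by rw [← ENNReal.mul_iSup, ← hα, ENNReal.inv_mul_cancel h0 hF1])
    (by rw [← ENNReal.mul_iSup, ← hβ, ENNReal.inv_mul_cancel h0' hG1])
    (fun x y => by rw [e]; gcongr; exact h x y)
  rw [lintegral_const_mul _ hF, lintegral_const_mul _ hG, lintegral_const_mul _ hH, e] at this
  exact (ENNReal.mul_le_mul_iff_right hc0 hct).mp this

/-- The measure `μ` satisfies the Prékopa–Leindler inequality: `∫ H ≥ (∫ F)^a (∫ G)^b` whenever
`H` at the convex combination `a x + b y` is at least `F(x)^a G(y)^b`. -/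
def PrekopaLeindler {E : Type*} [AddCommGroup E] [Module ℝ E] [MeasurableSpace E]
    (μ : Measure E) : Prop :=
  ∀ ⦃a b : ℝ⦄, 0 < a → 0 < b → a + b = 1 → ∀ ⦃F G H : E → ℝ≥0∞⦄, Measurable F →
    Measurable G → Measurable H → (∀ x y, F x ^ a * G y ^ b ≤ H (a • x + b • y)) →
    (∫⁻ x, F x ∂μ) ^ a * (∫⁻ x, G x ∂μ) ^ b ≤ ∫⁻ x, H x ∂μ

/-- The general case on the line follows from the bounded one by truncation. -/
theorem prekopaLeindler_real : PrekopaLeindler (volume : Measure ℝ) := by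
  intro a b ha hb hab F G H hF hG hH h
  rcases eq_or_ne (∫⁻ x, F x) 0 with h0 | h0
  · simp [h0, ha]
  rcases eq_or_ne (∫⁻ x, G x) 0 with h0' | h0'
  · simp [h0', hb]
  have lim : ∀ {f : ℝ → ℝ≥0∞}, Measurable f →
      Tendsto (fun n : ℕ => ∫⁻ x, min (f x) n) atTop (𝓝 (∫⁻ x, f x)) := by
    intro f hf
    refine lintegral_tendsto_of_tendsto_of_monotone
      (fun n => (hf.min measurable_const).aemeasurable)
      (Eventually.of_forall fun x m n hmn => min_le_min_left _ (by exact_mod_cast hmn))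
      (Eventually.of_forall fun x => ?_)
    simpa using (tendsto_const_nhds (x := f x)).min ENNReal.tendsto_nat_nhds_top
  have bdd : ∀ (f : ℝ → ℝ≥0∞) (n : ℕ), ⨆ x, min (f x) n ≠ ⊤ := fun f n =>
    ((iSup_le fun x => min_le_right _ _).trans_lt (ENNReal.natCast_lt_top n)).ne
  refine le_of_tendsto' (ENNReal.Tendsto.mul ((ENNReal.continuous_rpow_const.tendsto _).comp
    (lim hF)) (Or.inl ?_) ((ENNReal.continuous_rpow_const.tendsto _).comp (lim hG)) (Or.inl ?_))
    fun n => prekopaLeindler_real_of_bounded ha hb hab (hF.min measurable_const)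
      (hG.min measurable_const) hH (bdd F n) (bdd G n) fun x y => le_trans ?_ (h x y)
  · simp [ENNReal.rpow_eq_zero_iff, h0, ha.le]
  · simp [ENNReal.rpow_eq_zero_iff, h0', hb.le]
  · gcongr <;> exact min_le_left _ _

/-- The inequality tensorizes: apply it in the second variable to the slices, then in the first
variable to the slice integrals. -/
theorem PrekopaLeindler.prod {E₁ E₂ : Type*} [AddCommGroup E₁] [Module ℝ E₁]
    [MeasurableSpace E₁] [AddCommGroup E₂] [Module ℝ E₂] [MeasurableSpace E₂]
    {μ : Measure E₁} {ν : Measure E₂} [SFinite ν] (h₁ : PrekopaLeindler μ)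
    (h₂ : PrekopaLeindler ν) : PrekopaLeindler (μ.prod ν) := by
  intro a b ha hb hab F G H hF hG hH h
  rw [lintegral_prod _ hF.aemeasurable, lintegral_prod _ hG.aemeasurable,
    lintegral_prod _ hH.aemeasurable]
  refine h₁ ha hb hab hF.lintegral_prod_right' hG.lintegral_prod_right'
    hH.lintegral_prod_right' fun x y => ?_
  exact h₂ ha hb hab (hF.comp measurable_prodMk_left) (hG.comp measurable_prodMk_left)
    (hH.comp measurable_prodMk_left) fun x' y' => h (x, x') (y, y')

/-- The Prékopa–Leindler inequality passes to images under linear isomorphisms. -/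
theorem PrekopaLeindler.of_measurePreserving {E₁ E₂ : Type*} [AddCommGroup E₁] [Module ℝ E₁]
    [MeasurableSpace E₁] [AddCommGroup E₂] [Module ℝ E₂] [MeasurableSpace E₂]
    {μ : Measure E₁} {ν : Measure E₂} (e : E₂ →ₗ[ℝ] E₁) (he : MeasurePreserving e ν μ)
    (h₂ : PrekopaLeindler ν) : PrekopaLeindler μ := by
  intro a b ha hb hab F G H hF hG hH h
  rw [← he.lintegral_comp hF, ← he.lintegral_comp hG, ← he.lintegral_comp hH]
  exact h₂ ha hb hab (hF.comp he.measurable) (hG.comp he.measurable) (hH.comp he.measurable)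
    fun x y => by simpa using h (e x) (e y)

theorem prekopaLeindler_fin (n : ℕ) : PrekopaLeindler (volume : Measure (Fin n → ℝ)) := by
  induction n with
  | zero =>
    intro a b ha hb hab F G H hF hG hH h
    simp only [volume_pi, Measure.pi_of_empty _ (0 : Fin 0 → ℝ), lintegral_dirac]
    simpa using h 0 0
  | succ n ih =>
    let e : (ℝ × (Fin n → ℝ)) →ₗ[ℝ] (Fin (n + 1) → ℝ) :=
      { toFun := fun p => Fin.cons p.1 p.2
        map_add' := fun p q => by ext i; refine Fin.cases ?_ (fun j => ?_) i <;> simp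
        map_smul' := fun r p => by ext i; refine Fin.cases ?_ (fun j => ?_) i <;> simp }
    have he : MeasurePreserving e (volume.prod volume) volume := by
      have h : ⇑e = (MeasurableEquiv.piFinSuccAbove (fun _ : Fin (n + 1) => ℝ) 0).symm := by
        funext p
        simp only [MeasurableEquiv.piFinSuccAbove, Fin.insertNthEquiv_zero]
        rfl
      rw [h]
      exact (volume_preserving_piFinSuccAbove (fun _ : Fin (n + 1) => ℝ) 0).symm _
    exact (prekopaLeindler_real.prod ih).of_measurePreserving e he

theorem prekopaLeindler_volume (E : Type*) [NormedAddCommGroup E] [InnerProductSpace ℝ E]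
    [FiniteDimensional ℝ E] [MeasurableSpace E] [BorelSpace E] :
    PrekopaLeindler (volume : Measure E) :=
  (prekopaLeindler_fin _).of_measurePreserving
    ((stdOrthonormalBasis ℝ E).repr.symm.toLinearEquiv.toLinearMap ∘ₗ
      (WithLp.linearEquiv 2 ℝ (Fin (Module.finrank ℝ E) → ℝ)).symm.toLinearMap)
    ((stdOrthonormalBasis ℝ E).measurePreserving_repr_symm.comp (PiLp.volume_preserving_toLp _))

/-! ### Gaussian measures on a Euclidean space -/

section Gaussian

variable {E : Type*} [NormedAddCommGroup E]

/-- The unnormalized density of the centred Gaussian measure with covariance `s • 1`. -/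
def gaussianWeight (s : ℝ) (x : E) : ℝ := Real.exp (-(‖x‖ ^ 2 / (2 * s)))

theorem gaussianWeight_pos (s : ℝ) (x : E) : 0 < gaussianWeight s x := Real.exp_pos _

theorem continuous_gaussianWeight (s : ℝ) : Continuous (gaussianWeight s : E → ℝ) := by
  unfold gaussianWeight; fun_prop

theorem gaussianWeight_eq (s : ℝ) (x : E) :
    gaussianWeight s x = Real.exp (-(1 / (2 * s)) * ‖x‖ ^ 2) := by
  rw [gaussianWeight]; congr 1; ring

variable [InnerProductSpace ℝ E] [FiniteDimensional ℝ E] [MeasurableSpace E] [BorelSpace E]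

open Classical in
/-- The centred Gaussian measure with covariance `s • 1`, a point mass for `s = 0`. -/
def heatMeasure (E : Type*) [NormedAddCommGroup E] [InnerProductSpace ℝ E]
    [FiniteDimensional ℝ E] [MeasurableSpace E] [BorelSpace E] (s : ℝ) : Measure E :=
  if s = 0 then Measure.dirac 0
  else (∫⁻ x : E, ENNReal.ofReal (gaussianWeight s x))⁻¹ •
    (volume : Measure E).withDensity fun x => ENNReal.ofReal (gaussianWeight s x)

theorem integrable_exp_neg_mul_sq {b : ℝ} (hb : 0 < b) :
    Integrable fun x : E => Real.exp (-b * ‖x‖ ^ 2) := by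
  have := (GaussianFourier.integrable_cexp_neg_mul_sq_norm_add (V := E) (b := b) (by simpa) 0 0).re
  refine this.congr (Eventually.of_forall fun x => ?_)
  have : (-(b : ℂ) * (‖x‖ : ℂ) ^ 2 + 0 * (inner ℝ (0 : E) x : ℝ)) = ((-b * ‖x‖ ^ 2 : ℝ) : ℂ) := by
    push_cast; ring
  simp only [this]
  exact Complex.exp_ofReal_re _

theorem integrable_exp_neg_mul_sq_add {b : ℝ} (hb : 0 < b) (B : ℝ) :
    Integrable fun x : E => Real.exp (-b * ‖x‖ ^ 2 + B * ‖x‖) := by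
  refine Integrable.mono' ((integrable_exp_neg_mul_sq (E := E) (half_pos hb)).const_mul
    (Real.exp (B ^ 2 / (2 * b)))) (by fun_prop) (Eventually.of_forall fun x => ?_)
  rw [Real.norm_of_nonneg (Real.exp_pos _).le, ← Real.exp_add, Real.exp_le_exp]
  have h : B ^ 2 / (2 * b) + -(b / 2) * ‖x‖ ^ 2 - (-b * ‖x‖ ^ 2 + B * ‖x‖)
      = (b * ‖x‖ - B) ^ 2 / (2 * b) := by field_simp; ring
  have : 0 ≤ (b * ‖x‖ - B) ^ 2 / (2 * b) := by positivity
  linarith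

theorem integrable_gaussianWeight {s : ℝ} (hs : 0 < s) :
    Integrable (gaussianWeight s : E → ℝ) := by
  refine (integrable_exp_neg_mul_sq (E := E) (b := 1 / (2 * s)) (by positivity)).congr
    (Eventually.of_forall fun x => (gaussianWeight_eq s x).symm)

theorem integral_gaussianWeight {s : ℝ} (hs : 0 < s) :
    ∫ x : E, gaussianWeight s x = (2 * Real.pi * s) ^ (Module.finrank ℝ E / 2 : ℝ) := by
  have := GaussianFourier.integral_rexp_neg_mul_sq_norm (V := E) (b := 1 / (2 * s))
    (by positivity)
  simp only [gaussianWeight_eq]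
  rw [this]
  congr 1
  field_simp

theorem integral_gaussianWeight_pos {s : ℝ} (hs : 0 < s) :
    0 < ∫ x : E, gaussianWeight s x := by
  rw [integral_gaussianWeight hs]
  positivity

theorem lintegral_gaussianWeight {s : ℝ} (hs : 0 < s) :
    ∫⁻ x : E, ENNReal.ofReal (gaussianWeight s x)
      = ENNReal.ofReal (∫ x : E, gaussianWeight s x) :=
  (ofReal_integral_eq_lintegral_ofReal (integrable_gaussianWeight hs)
    (Eventually.of_forall fun x => (gaussianWeight_pos s x).le)).symm

@[simp] theorem heatMeasure_zero : heatMeasure E 0 = Measure.dirac 0 := if_pos rfl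

theorem heatMeasure_of_pos {s : ℝ} (hs : 0 < s) :
    heatMeasure E s = (∫⁻ x : E, ENNReal.ofReal (gaussianWeight s x))⁻¹ •
      (volume : Measure E).withDensity fun x => ENNReal.ofReal (gaussianWeight s x) :=
  if_neg hs.ne'

theorem lintegral_heatMeasure {s : ℝ} (hs : 0 < s) (f : E → ℝ≥0∞) :
    ∫⁻ x, f x ∂(heatMeasure E s) = (∫⁻ x : E, ENNReal.ofReal (gaussianWeight s x))⁻¹ *
      ∫⁻ x : E, ENNReal.ofReal (gaussianWeight s x) * f x := by
  rw [heatMeasure_of_pos hs, lintegral_smul_measure,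
    lintegral_withDensity_eq_lintegral_mul_non_measurable _
      (continuous_gaussianWeight s).measurable.ennreal_ofReal (by simp)]
  simp

theorem integral_heatMeasure {F : Type*} [NormedAddCommGroup F] [NormedSpace ℝ F]
    {s : ℝ} (hs : 0 < s) (f : E → F) :
    ∫ x, f x ∂(heatMeasure E s) = (∫ x : E, gaussianWeight s x)⁻¹ •
      ∫ x : E, gaussianWeight s x • f x := by
  rw [heatMeasure_of_pos hs, integral_smul_measure, integral_withDensity_eq_integral_toReal_smul
    (continuous_gaussianWeight s).measurable.ennreal_ofReal (by simp), lintegral_gaussianWeight hs,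
    ENNReal.toReal_inv, ENNReal.toReal_ofReal (integral_gaussianWeight_pos hs).le]
  simp only [ENNReal.toReal_ofReal (gaussianWeight_pos s _).le]

theorem integrable_heatMeasure_iff {F : Type*} [NormedAddCommGroup F] [NormedSpace ℝ F]
    {s : ℝ} (hs : 0 < s) {f : E → F} :
    Integrable f (heatMeasure E s) ↔ Integrable fun x => gaussianWeight s x • f x := by
  rw [heatMeasure_of_pos hs, lintegral_gaussianWeight hs, integrable_smul_measure (by simp)
    (by simpa using integral_gaussianWeight_pos hs), integrable_withDensity_iff_integrable_smul'
    (continuous_gaussianWeight s).measurable.ennreal_ofReal (by simp)]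
  simp only [ENNReal.toReal_ofReal (gaussianWeight_pos s _).le]

theorem isProbabilityMeasure_heatMeasure {s : ℝ} (hs : 0 ≤ s) :
    IsProbabilityMeasure (heatMeasure E s) := by
  rcases hs.eq_or_lt with rfl | hs
  · rw [heatMeasure_zero]; infer_instance
  · refine ⟨?_⟩
    rw [← lintegral_one, lintegral_heatMeasure hs]
    simp only [mul_one]
    refine ENNReal.inv_mul_cancel ?_ ?_ <;> rw [lintegral_gaussianWeight hs]
    · simpa using integral_gaussianWeight_pos hs
    · simp

theorem charFun_heatMeasure {s : ℝ} (hs : 0 ≤ s) (w : E) :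
    charFun (heatMeasure E s) w = Complex.exp (-(s * ‖w‖ ^ 2 / 2)) := by
  rcases hs.eq_or_lt with rfl | hs
  · simp [charFun_apply]
  rw [charFun_apply, integral_heatMeasure hs]
  have hb : 0 < ((1 / (2 * s) : ℝ) : ℂ).re := by rw [Complex.ofReal_re]; positivity
  have h1 := GaussianFourier.integral_cexp_neg_mul_sq_norm_add (V := E) hb Complex.I w
  have h2 := GaussianFourier.integral_cexp_neg_mul_sq_norm_add (V := E) hb 0 0
  have e0 : ((∫ x : E, gaussianWeight s x : ℝ) : ℂ)
      = (Real.pi / ((1 / (2 * s) : ℝ) : ℂ)) ^ (Module.finrank ℝ E / 2 : ℂ) := by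
    rw [← integral_complex_ofReal]
    simp only [ne_eq, OfNat.ofNat_ne_zero, not_false_eq_true, zero_pow, zero_mul, norm_zero,
      Complex.ofReal_zero, zero_div, Complex.exp_zero, mul_one, add_zero] at h2
    rw [← h2]
    congr 1; ext x
    rw [gaussianWeight_eq]
    push_cast; rfl
  have hne : (Real.pi / ((1 / (2 * s) : ℝ) : ℂ)) ^ (Module.finrank ℝ E / 2 : ℂ) ≠ 0 := by
    rw [← e0]; exact_mod_cast (integral_gaussianWeight_pos (E := E) hs).ne'
  have e1 : ∫ x : E, gaussianWeight s x • Complex.exp ((inner ℝ x w : ℝ) * Complex.I)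
      = (Real.pi / ((1 / (2 * s) : ℝ) : ℂ)) ^ (Module.finrank ℝ E / 2 : ℂ) *
        Complex.exp (-(s * ‖w‖ ^ 2 / 2)) := by
    have : Complex.exp (-((s : ℂ) * ‖w‖ ^ 2 / 2))
        = Complex.exp (Complex.I ^ 2 * (‖w‖ : ℂ) ^ 2 / (4 * ((1 / (2 * s) : ℝ) : ℂ))) := by
      congr 1
      have : (s : ℂ) ≠ 0 := by exact_mod_cast hs.ne'
      rw [Complex.I_sq]; push_cast; field_simp; ring
    rw [this, ← h1]
    congr 1; ext x
    rw [gaussianWeight_eq, Complex.real_smul, Complex.ofReal_exp, ← Complex.exp_add,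
      real_inner_comm]
    push_cast; congr 1; ring
  rw [e1, Complex.real_smul, Complex.ofReal_inv, e0, inv_mul_cancel_left₀ hne]

theorem heatMeasure_conv {s t : ℝ} (hs : 0 ≤ s) (ht : 0 ≤ t) :
    (heatMeasure E s).conv (heatMeasure E t) = heatMeasure E (s + t) := by
  have := isProbabilityMeasure_heatMeasure (E := E) hs
  have := isProbabilityMeasure_heatMeasure (E := E) ht
  have := isProbabilityMeasure_heatMeasure (E := E) (add_nonneg hs ht)
  refine Measure.ext_of_charFun (funext fun w => ?_)
  rw [charFun_conv, charFun_heatMeasure hs, charFun_heatMeasure ht,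
    charFun_heatMeasure (add_nonneg hs ht), ← Complex.exp_add]
  congr 1; push_cast; ring

theorem heatMeasure_map_smul {s : ℝ} (hs : 0 ≤ s) (r : ℝ) :
    (heatMeasure E s).map (fun x => r • x) = heatMeasure E (r ^ 2 * s) := by
  have := isProbabilityMeasure_heatMeasure (E := E) hs
  have := isProbabilityMeasure_heatMeasure (E := E) (mul_nonneg (sq_nonneg r) hs)
  have : IsProbabilityMeasure ((heatMeasure E s).map (fun x => r • x)) :=
    Measure.isProbabilityMeasure_map (by fun_prop)
  refine Measure.ext_of_charFun (funext fun w => ?_)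
  rw [charFun_map_smul, charFun_heatMeasure hs, charFun_heatMeasure (mul_nonneg (sq_nonneg r) hs),
    norm_smul]
  congr 1; push_cast
  rw [mul_pow, ← Complex.ofReal_pow, ← Complex.ofReal_pow ‖w‖, Real.norm_eq_abs, sq_abs]
  push_cast; ring

theorem heatMeasure_eq_map {s : ℝ} (hs : 0 ≤ s) :
    heatMeasure E s = (heatMeasure E 1).map (fun x => √s • x) := by
  rw [heatMeasure_map_smul zero_le_one, Real.sq_sqrt hs, mul_one]

theorem heatMeasure_map_neg {s : ℝ} (hs : 0 ≤ s) :
    (heatMeasure E s).map (fun x => -x) = heatMeasure E s := by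
  simpa using heatMeasure_map_smul (E := E) hs (-1)

theorem integral_comp_neg_heatMeasure {s : ℝ} (hs : 0 ≤ s) (f : E → ℝ) :
    ∫ x, f (-x) ∂(heatMeasure E s) = ∫ x, f x ∂(heatMeasure E s) := by
  conv_rhs => rw [← heatMeasure_map_neg hs]
  exact ((Homeomorph.neg E).measurableEmbedding.integral_map f).symm

theorem integrable_exp_norm_heatMeasure {s : ℝ} (hs : 0 ≤ s) (B : ℝ) :
    Integrable (fun x => Real.exp (B * ‖x‖)) (heatMeasure E s) := by
  rcases hs.eq_or_lt with rfl | hs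
  · rw [heatMeasure_zero]
    exact integrable_dirac (by simp)
  rw [integrable_heatMeasure_iff hs]
  refine (integrable_exp_neg_mul_sq_add (E := E) (b := 1 / (2 * s)) (by positivity) B).congr
    (Eventually.of_forall fun x => ?_)
  simp only [gaussianWeight_eq, smul_eq_mul, ← Real.exp_add]

theorem integrable_norm_sq_heatMeasure {s : ℝ} (hs : 0 ≤ s) :
    Integrable (fun x => ‖x‖ ^ 2) (heatMeasure E s) := by
  refine ((integrable_exp_norm_heatMeasure hs 1).const_mul 2).mono'
    (by fun_prop) (Eventually.of_forall fun x => ?_)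
  rw [Real.norm_of_nonneg (by positivity), one_mul]
  have := Real.quadratic_le_exp_of_nonneg (norm_nonneg x)
  nlinarith [norm_nonneg x]

theorem integrable_heatMeasure_of_le {s : ℝ} (hs : 0 ≤ s) {f : E → ℝ} (hf : Continuous f)
    {A B : ℝ} (h : ∀ x, |f x| ≤ A + B * ‖x‖ ^ 2) : Integrable f (heatMeasure E s) := by
  have := isProbabilityMeasure_heatMeasure (E := E) hs
  exact ((integrable_const A).add ((integrable_norm_sq_heatMeasure hs).const_mul B)).mono'
    hf.aestronglyMeasurable (Eventually.of_forall h)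

theorem integral_norm_sq_heatMeasure {s : ℝ} (hs : 0 ≤ s) :
    ∫ x, ‖x‖ ^ 2 ∂(heatMeasure E s) = s * ∫ x, ‖x‖ ^ 2 ∂(heatMeasure E 1) := by
  rw [heatMeasure_eq_map hs, integral_map (by fun_prop) (by fun_prop), ← integral_const_mul]
  congr 1; ext x
  rw [norm_smul, mul_pow, Real.norm_eq_abs, sq_abs, Real.sq_sqrt hs]

theorem integral_inner_heatMeasure {s : ℝ} (hs : 0 ≤ s) (w : E) :
    ∫ x, inner ℝ w x ∂(heatMeasure E s) = 0 := by
  have := integral_comp_neg_heatMeasure hs (fun x : E => (inner ℝ w x : ℝ))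
  simp only [inner_neg_right, integral_neg] at this
  linarith

/-- The Cameron–Martin formula for a translate of a Gaussian measure. -/
theorem integral_add_heatMeasure {s : ℝ} (hs : 0 < s) (f : E → ℝ) (w : E) :
    ∫ x, f (w + x) ∂(heatMeasure E s)
      = ∫ x, Real.exp (inner ℝ w x / s - ‖w‖ ^ 2 / (2 * s)) * f x ∂(heatMeasure E s) := by
  rw [integral_heatMeasure hs, integral_heatMeasure hs]
  congr 1
  rw [← integral_add_left_eq_self _ (-w)]
  congr 1; ext x
  simp only [smul_eq_mul, add_neg_cancel_left, gaussianWeight, ← mul_assoc, ← Real.exp_add]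
  congr 2
  rw [neg_add_eq_sub, @norm_sub_sq_real]
  rw [real_inner_comm]
  field_simp
  ring

end Gaussian

/-! ### The dual form of Talagrand's transport inequality -/

theorem ofReal_exp_integral_le {α : Type*} [MeasurableSpace α] {μ : Measure α}
    [IsProbabilityMeasure μ] {g : α → ℝ} (hg : Integrable g μ) :
    ENNReal.ofReal (Real.exp (∫ x, g x ∂μ)) ≤ ∫⁻ x, ENNReal.ofReal (Real.exp (g x)) ∂μ := by
  -- Integrate the tangent line bound of `exp` at the mean of `g`.
  set m := ∫ x, g x ∂μ with hm
  have hi : Integrable (fun x => Real.exp m * (1 + (g x - m))) μ :=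
    ((integrable_const _).add (hg.sub (integrable_const _))).const_mul _
  have h1 : ∫ x, Real.exp m * (1 + (g x - m)) ∂μ = Real.exp m := by
    have h2 : ∫ x, (g x - m) ∂μ = 0 := by
      rw [integral_sub hg (integrable_const _)]
      simp [← hm]
    have h3 : ∫ x, (1 + (g x - m)) ∂μ = ∫ _, (1 : ℝ) ∂μ + ∫ x, (g x - m) ∂μ :=
      integral_add (integrable_const _) (hg.sub (integrable_const _))
    rw [integral_const_mul, h3, h2]
    simp
  calc ENNReal.ofReal (Real.exp m)
      = ENNReal.ofReal (∫ x, Real.exp m * (1 + (g x - m)) ∂μ) := by rw [h1]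
    _ ≤ ENNReal.ofReal (∫ x, max (Real.exp m * (1 + (g x - m))) 0 ∂μ) :=
        ENNReal.ofReal_le_ofReal (integral_mono hi hi.pos_part fun x => le_max_left _ _)
    _ = ∫⁻ x, ENNReal.ofReal (max (Real.exp m * (1 + (g x - m))) 0) ∂μ :=
        ofReal_integral_eq_lintegral_ofReal hi.pos_part
          (Eventually.of_forall fun x => le_max_right _ _)
    _ ≤ ∫⁻ x, ENNReal.ofReal (Real.exp (g x)) ∂μ := by
        refine lintegral_mono fun x => ENNReal.ofReal_le_ofReal (max_le ?_ (Real.exp_pos _).le)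
        have h2 := Real.add_one_le_exp (g x - m)
        calc Real.exp m * (1 + (g x - m)) ≤ Real.exp m * Real.exp (g x - m) := by
              gcongr; linarith
          _ = Real.exp (g x) := by rw [← Real.exp_add]; congr 1; ring

section Talagrand

variable {E : Type*} [NormedAddCommGroup E] [InnerProductSpace ℝ E]

theorem norm_sq_add_smul (a b : ℝ) (hab : a + b = 1) (x y : E) :
    ‖a • x + b • y‖ ^ 2 = a * ‖x‖ ^ 2 + b * ‖y‖ ^ 2 - a * b * ‖x - y‖ ^ 2 := by
  rw [norm_add_sq_real, norm_sub_sq_real, norm_smul, norm_smul, inner_smul_left, inner_smul_right,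
    mul_pow, mul_pow, Real.norm_eq_abs, Real.norm_eq_abs, sq_abs, sq_abs]
  obtain rfl : b = 1 - a := by linarith
  simp
  ring

variable [FiniteDimensional ℝ E] [MeasurableSpace E] [BorelSpace E]

/-- The Prékopa–Leindler inequality for `exp (b h)` and `exp (-a f)` with respect to the
Gaussian measure. The quadratic form of the exponent absorbs the cost `‖x - y‖² / (2s)`. -/
theorem lintegral_exp_rpow_mul_le {s : ℝ} (hs : 0 < s) {h f : E → ℝ} (hh : Measurable h)
    (hf : Measurable f) (H : ∀ x y, h x ≤ f y + ‖x - y‖ ^ 2 / (2 * s)) {a b : ℝ} (ha : 0 < a)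
    (hb : 0 < b) (hab : a + b = 1) :
    (∫⁻ x, ENNReal.ofReal (Real.exp (b * h x)) ∂(heatMeasure E s)) ^ a *
      (∫⁻ x, ENNReal.ofReal (Real.exp (-(a * f x))) ∂(heatMeasure E s)) ^ b ≤ 1 := by
  have hg : Measurable (gaussianWeight s : E → ℝ) := (continuous_gaussianWeight s).measurable
  have key := prekopaLeindler_volume E ha hb hab
    (F := fun x => ENNReal.ofReal (gaussianWeight s x) * ENNReal.ofReal (Real.exp (b * h x)))
    (G := fun x => ENNReal.ofReal (gaussianWeight s x) * ENNReal.ofReal (Real.exp (-(a * f x))))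
    (H := fun x => ENNReal.ofReal (gaussianWeight s x)) (by fun_prop) (by fun_prop) (by fun_prop)
    fun x y => by
      simp only [gaussianWeight, ← ENNReal.ofReal_mul (Real.exp_pos _).le, ← Real.exp_add]
      rw [ENNReal.ofReal_rpow_of_pos (Real.exp_pos _), ENNReal.ofReal_rpow_of_pos (Real.exp_pos _),
        ← Real.exp_mul, ← Real.exp_mul, ← ENNReal.ofReal_mul (Real.exp_pos _).le, ← Real.exp_add]
      refine ENNReal.ofReal_le_ofReal (Real.exp_le_exp.mpr ?_)
      rw [norm_sq_add_smul a b hab]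
      have := mul_le_mul_of_nonneg_left (H x y) (mul_pos ha hb).le
      have e : -((a * ‖x‖ ^ 2 + b * ‖y‖ ^ 2 - a * b * ‖x - y‖ ^ 2) / (2 * s))
          = -(a * (‖x‖ ^ 2 / (2 * s))) - b * (‖y‖ ^ 2 / (2 * s))
            + a * b * (‖x - y‖ ^ 2 / (2 * s)) := by ring
      rw [e]
      linarith
  rw [lintegral_heatMeasure hs, lintegral_heatMeasure hs, ENNReal.mul_rpow_of_nonneg _ _ ha.le,
    ENNReal.mul_rpow_of_nonneg _ _ hb.le, mul_mul_mul_comm]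
  set Z := ∫⁻ x : E, ENNReal.ofReal (gaussianWeight s x) with hZ
  have hZ0 : Z ≠ 0 := by
    rw [hZ, lintegral_gaussianWeight hs]; simpa using integral_gaussianWeight_pos hs
  have hZt : Z ≠ ⊤ := by rw [hZ, lintegral_gaussianWeight hs]; simp
  rw [← ENNReal.rpow_add _ _ (by simpa) (by simpa), hab, ENNReal.rpow_one]
  calc Z⁻¹ * _ ≤ Z⁻¹ * Z := by gcongr
    _ = 1 := ENNReal.inv_mul_cancel hZ0 hZt

/-- The dual form (due to Bobkov and Götze) of Talagrand's transport inequality for a Gaussian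
measure; it is the limit `b → 0` of `lintegral_exp_rpow_mul_le`. -/
theorem lintegral_exp_neg_le {s : ℝ} (hs : 0 < s) {h f : E → ℝ} (hh : Measurable h)
    (hf : Measurable f) (hi : Integrable h (heatMeasure E s))
    (H : ∀ x y, h x ≤ f y + ‖x - y‖ ^ 2 / (2 * s)) :
    ∫⁻ x, ENNReal.ofReal (Real.exp (-f x)) ∂(heatMeasure E s)
      ≤ ENNReal.ofReal (Real.exp (-∫ x, h x ∂(heatMeasure E s))) := by
  have := isProbabilityMeasure_heatMeasure (E := E) hs.le
  set m := ∫ x, h x ∂(heatMeasure E s) with hm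
  have step : ∀ {a b : ℝ}, 0 < a → 0 < b → a + b = 1 →
      ∫⁻ x, ENNReal.ofReal (Real.exp (-(a * f x))) ∂(heatMeasure E s)
        ≤ ENNReal.ofReal (Real.exp (-(a * m))) := by
    intro a b ha hb hab
    set Y := ∫⁻ x, ENNReal.ofReal (Real.exp (-(a * f x))) ∂(heatMeasure E s)
    have h1 := ofReal_exp_integral_le (hi.const_mul b)
    rw [integral_const_mul, ← hm] at h1
    have h2 : ENNReal.ofReal (Real.exp (b * m)) ^ a * Y ^ b ≤ 1 :=
      le_trans (by gcongr) (lintegral_exp_rpow_mul_le hs hh hf H ha hb hab)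
    refine (ENNReal.rpow_le_rpow_iff hb).mp ?_
    rw [ENNReal.ofReal_rpow_of_pos (Real.exp_pos _), ← Real.exp_mul] at h2 ⊢
    have h3 : -(a * m) * b = -(b * m * a) := by ring
    rw [h3, Real.exp_neg, ENNReal.ofReal_inv_of_pos (Real.exp_pos _)]
    rw [mul_comm] at h2
    exact ENNReal.le_inv_iff_mul_le.mpr h2
  have hl : Tendsto (fun n : ℕ => 1 - 1 / ((n : ℝ) + 2)) atTop (𝓝 1) := by
    have h2 : Tendsto (fun n : ℕ => (n : ℝ) + 2) atTop atTop :=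
      tendsto_atTop_add_const_right _ _ tendsto_natCast_atTop_atTop
    simpa using h2.inv_tendsto_atTop.const_sub 1
  have lim : ∀ r : ℝ, Tendsto (fun n : ℕ =>
      ENNReal.ofReal (Real.exp (-((1 - 1 / ((n : ℝ) + 2)) * r)))) atTop
      (𝓝 (ENNReal.ofReal (Real.exp (-r)))) := fun r => by
    refine ENNReal.tendsto_ofReal ((Real.continuous_exp.tendsto _).comp ?_)
    simpa using (hl.mul_const r).neg
  calc ∫⁻ x, ENNReal.ofReal (Real.exp (-f x)) ∂(heatMeasure E s)
      = ∫⁻ x, liminf (fun n : ℕ =>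
          ENNReal.ofReal (Real.exp (-((1 - 1 / ((n : ℝ) + 2)) * f x)))) atTop
          ∂(heatMeasure E s) := by simp only [(lim _).liminf_eq]
    _ ≤ liminf (fun n : ℕ => ∫⁻ x,
          ENNReal.ofReal (Real.exp (-((1 - 1 / ((n : ℝ) + 2)) * f x)))
          ∂(heatMeasure E s)) atTop := lintegral_liminf_le fun n => by fun_prop
    _ ≤ liminf (fun n : ℕ =>
          ENNReal.ofReal (Real.exp (-((1 - 1 / ((n : ℝ) + 2)) * m)))) atTop := by
        refine liminf_le_liminf (Eventually.of_forall fun n => ?_)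
        refine step (b := 1 / ((n : ℝ) + 2)) ?_ (by positivity) (by ring)
        have : (1 : ℝ) / ((n : ℝ) + 2) < 1 := by
          rw [div_lt_one (by positivity)]; linarith [(Nat.cast_nonneg n : (0 : ℝ) ≤ n)]
        linarith
    _ = _ := (lim m).liminf_eq

end Talagrand

/-! ### Convex functions of at most quadratic growth -/

section Operators

variable {E : Type*} [NormedAddCommGroup E]

/-- The inf-convolution of `f` with `‖·‖² / (2s)`. -/
def infConv (s : ℝ) (f : E → ℝ) (x : E) : ℝ := ⨅ y : E, (f (x + y) + ‖y‖ ^ 2 / (2 * s))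

variable [InnerProductSpace ℝ E]

/-- The convex functions that are bounded above by a quadratic polynomial in the norm. -/
structure QuadConvex (f : E → ℝ) : Prop where
  convexOn : ConvexOn ℝ univ f
  exists_le : ∃ a b : ℝ, 0 ≤ b ∧ ∀ x, f x ≤ a + b * ‖x‖ ^ 2

theorem convexOn_norm_sq : ConvexOn ℝ univ fun x : E => ‖x‖ ^ 2 :=
  (convexOn_norm convex_univ).pow (fun _ _ => norm_nonneg _) 2

theorem norm_add_sq_le (x y : E) : ‖x + y‖ ^ 2 ≤ 2 * ‖x‖ ^ 2 + 2 * ‖y‖ ^ 2 := by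
  have := parallelogram_law_with_norm ℝ x y
  nlinarith [mul_self_nonneg ‖x - y‖]

theorem QuadConvex.comp_add_left {f : E → ℝ} (hf : QuadConvex f) (x : E) :
    QuadConvex fun y => f (x + y) := by
  obtain ⟨a, b, hb, h⟩ := hf.exists_le
  refine ⟨by simpa [Function.comp_def] using hf.convexOn.translate_right x,
    a + b * (2 * ‖x‖ ^ 2), b * 2, by positivity, fun y => (h _).trans ?_⟩
  have := mul_le_mul_of_nonneg_left (norm_add_sq_le x y) hb
  linarith

section FiniteDimensional

variable [FiniteDimensional ℝ E]

theorem _root_.ConvexOn.continuous_of_univ {f : E → ℝ} (hf : ConvexOn ℝ univ f) : Continuous f :=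
  continuousOn_univ.mp (hf.continuousOn isOpen_univ)

/-- A convex function is bounded below by an affine function of the norm: `0` is a convex
combination of `x` and `-x / ‖x‖`, and the function is bounded on the unit ball. -/
theorem _root_.ConvexOn.exists_neg_norm_le {f : E → ℝ} (hf : ConvexOn ℝ univ f) :
    ∃ A B : ℝ, 0 ≤ B ∧ ∀ x, -(A + B * ‖x‖) ≤ f x := by
  obtain ⟨M, hM⟩ := (isCompact_closedBall (0 : E) 1).exists_bound_of_continuousOn
    hf.continuous_of_univ.continuousOn
  have hM0 : ∀ x : E, ‖x‖ ≤ 1 → |f x| ≤ M := fun x hx => hM x (by simpa using hx)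
  have hMnn : 0 ≤ M := (abs_nonneg _).trans (hM0 0 (by simp))
  refine ⟨M, 2 * M, by positivity, fun x => ?_⟩
  have h0 := (abs_le.mp (hM0 0 (by simp))).1
  rcases eq_or_ne x 0 with rfl | hx
  · simpa using h0
  have hr : 0 < ‖x‖ := norm_pos_iff.mpr hx
  have h1 := (abs_le.mp (hM0 (-(‖x‖⁻¹ • x)) (by rw [norm_neg, norm_smul]; simp [hr.ne']))).2
  have h2 := hf.2 (mem_univ x) (mem_univ (-(‖x‖⁻¹ • x)))
    (by positivity : 0 ≤ 1 / (1 + ‖x‖)) (by positivity : 0 ≤ ‖x‖ / (1 + ‖x‖)) (by field_simp)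
  have h3 : (1 / (1 + ‖x‖)) • x + (‖x‖ / (1 + ‖x‖)) • -(‖x‖⁻¹ • x) = 0 := by
    rw [smul_neg, smul_smul, ← sub_eq_add_neg, ← sub_smul]
    have : 1 / (1 + ‖x‖) - ‖x‖ / (1 + ‖x‖) * ‖x‖⁻¹ = 0 := by field_simp; ring
    rw [this, zero_smul]
  rw [h3, smul_eq_mul, smul_eq_mul, div_mul_eq_mul_div, div_mul_eq_mul_div, ← add_div,
    le_div_iff₀ (by positivity)] at h2
  nlinarith

theorem QuadConvex.continuous {f : E → ℝ} (hf : QuadConvex f) : Continuous f :=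
  hf.convexOn.continuous_of_univ

theorem QuadConvex.exists_neg_norm_le {f : E → ℝ} (hf : QuadConvex f) :
    ∃ A B : ℝ, 0 ≤ B ∧ ∀ x, -(A + B * ‖x‖) ≤ f x :=
  hf.convexOn.exists_neg_norm_le

theorem QuadConvex.exists_abs_le {f : E → ℝ} (hf : QuadConvex f) :
    ∃ A B : ℝ, ∀ x, |f x| ≤ A + B * ‖x‖ ^ 2 := by
  obtain ⟨a, b, hb, h⟩ := hf.exists_le
  obtain ⟨A, B, hB, h'⟩ := hf.exists_neg_norm_le
  refine ⟨|a| + |A| + B, b + B, fun x => abs_le.mpr ⟨?_, ?_⟩⟩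
  · have := h' x
    nlinarith [le_abs_self A, abs_nonneg a, sq_nonneg ‖x‖, mul_nonneg hb (sq_nonneg ‖x‖),
      mul_nonneg hB (sq_nonneg (‖x‖ - 1)), norm_nonneg x, mul_nonneg hB (norm_nonneg x)]
  · have := h x
    nlinarith [le_abs_self a, abs_nonneg A, mul_nonneg hB (sq_nonneg ‖x‖)]

/-! ### The inf-convolution -/

theorem QuadConvex.bddBelow_infConv {f : E → ℝ} (hf : QuadConvex f) {s : ℝ} (hs : 0 < s) (x : E) :
    BddBelow (range fun y : E => f (x + y) + ‖y‖ ^ 2 / (2 * s)) := by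
  obtain ⟨A, B, hB, h⟩ := (hf.comp_add_left x).exists_neg_norm_le
  refine ⟨-A - B ^ 2 * s / 2, ?_⟩
  rintro _ ⟨y, rfl⟩
  have h1 : ‖y‖ ^ 2 / (2 * s) - B * ‖y‖ + B ^ 2 * s / 2 = (‖y‖ - B * s) ^ 2 / (2 * s) := by
    field_simp; ring
  have h2 : 0 ≤ (‖y‖ - B * s) ^ 2 / (2 * s) := by positivity
  have := h y
  simp only
  linarith

theorem QuadConvex.infConv_le_add {f : E → ℝ} (hf : QuadConvex f) {s : ℝ} (hs : 0 < s) (x y : E) :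
    infConv s f x ≤ f (x + y) + ‖y‖ ^ 2 / (2 * s) :=
  ciInf_le (hf.bddBelow_infConv hs x) y

theorem QuadConvex.infConv_le {f : E → ℝ} (hf : QuadConvex f) {s : ℝ} (hs : 0 < s) (x : E) :
    infConv s f x ≤ f x := by
  simpa using hf.infConv_le_add hs x 0

theorem QuadConvex.quadConvex_infConv {f : E → ℝ} (hf : QuadConvex f) {s : ℝ} (hs : 0 < s) :
    QuadConvex (infConv s f) := by
  obtain ⟨a, b, hb, h⟩ := hf.exists_le
  refine ⟨⟨convex_univ, fun x _ y _ p q hp hq hpq => ?_⟩, a, b, hb,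
    fun x => (hf.infConv_le hs x).trans (h x)⟩
  refine le_of_forall_pos_le_add fun ε hε => ?_
  obtain ⟨u, hu⟩ := exists_lt_of_ciInf_lt (lt_add_of_pos_right (infConv s f x) hε)
  obtain ⟨v, hv⟩ := exists_lt_of_ciInf_lt (lt_add_of_pos_right (infConv s f y) hε)
  have h1 := hf.infConv_le_add hs (p • x + q • y) (p • u + q • v)
  have h2 := hf.convexOn.2 (mem_univ (x + u)) (mem_univ (y + v)) hp hq hpq
  have h3 : ‖p • u + q • v‖ ^ 2 ≤ p • ‖u‖ ^ 2 + q • ‖v‖ ^ 2 :=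
    convexOn_norm_sq.2 (mem_univ u) (mem_univ v) hp hq hpq
  have h4 : p • x + q • y + (p • u + q • v) = p • (x + u) + q • (y + v) := by
    simp only [smul_add]; abel
  have h5 : ‖p • u + q • v‖ ^ 2 / (2 * s) ≤ p * (‖u‖ ^ 2 / (2 * s)) + q * (‖v‖ ^ 2 / (2 * s)) := by
    calc ‖p • u + q • v‖ ^ 2 / (2 * s) ≤ (p • ‖u‖ ^ 2 + q • ‖v‖ ^ 2) / (2 * s) := by gcongr
      _ = _ := by simp only [smul_eq_mul]; ring
  rw [h4] at h1
  have h6 := mul_le_mul_of_nonneg_left hu.le hp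
  have h7 := mul_le_mul_of_nonneg_left hv.le hq
  simp only [smul_eq_mul] at h2 ⊢
  have h8 : p * ε + q * ε = ε := by rw [← add_mul, hpq, one_mul]
  nlinarith

theorem infConv_mono_add {f g : E → ℝ} (hf : QuadConvex f) {s : ℝ} (hs : 0 < s) {K : ℝ}
    (h : ∀ x, f x ≤ g x + K) (x : E) : infConv s f x ≤ infConv s g x + K := by
  rw [← sub_le_iff_le_add]
  refine le_ciInf fun y => ?_
  have := hf.infConv_le_add hs x y
  linarith [h (x + y)]

/-! ### The heat semigroup and the Cole–Hopf semigroup -/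

variable [MeasurableSpace E] [BorelSpace E]

/-- The Gaussian average of `f`. -/
def heatOp (s : ℝ) (f : E → ℝ) (x : E) : ℝ := ∫ y, f (x + y) ∂(heatMeasure E s)

/-- The Cole–Hopf semigroup `-log (P_s exp (-f))`, which solves the viscous Hamilton–Jacobi
equation `∂_s u = ½ Δ u - ½ ‖∇ u‖²`. -/
def coleHopf (s : ℝ) (f : E → ℝ) (x : E) : ℝ := -Real.log (heatOp s (fun z => Real.exp (-f z)) x)

theorem QuadConvex.integrable {f : E → ℝ} (hf : QuadConvex f) {s : ℝ} (hs : 0 ≤ s) :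
    Integrable f (heatMeasure E s) := by
  obtain ⟨A, B, h⟩ := hf.exists_abs_le
  exact integrable_heatMeasure_of_le hs hf.continuous h

theorem integrable_exp_heatMeasure {g : E → ℝ} (hg : Continuous g) {A B : ℝ}
    (h : ∀ x, g x ≤ A + B * ‖x‖) {s : ℝ} (hs : 0 ≤ s) :
    Integrable (fun x => Real.exp (g x)) (heatMeasure E s) := by
  refine ((integrable_exp_norm_heatMeasure hs B).const_mul (Real.exp A)).mono'
    (by fun_prop) (Eventually.of_forall fun x => ?_)
  rw [Real.norm_of_nonneg (Real.exp_pos _).le, ← Real.exp_add]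
  exact Real.exp_le_exp.mpr (h x)

theorem QuadConvex.integrable_exp_neg {f : E → ℝ} (hf : QuadConvex f) {s : ℝ} (hs : 0 ≤ s) :
    Integrable (fun x => Real.exp (-f x)) (heatMeasure E s) := by
  obtain ⟨A, B, -, h⟩ := hf.exists_neg_norm_le
  exact integrable_exp_heatMeasure (g := fun x => -f x) hf.continuous.neg (A := A) (B := B)
    (fun x => by linarith [h x]) hs

theorem QuadConvex.heatOp_exp_neg_pos {f : E → ℝ} (hf : QuadConvex f) {s : ℝ} (hs : 0 ≤ s)
    (x : E) : 0 < heatOp s (fun z => Real.exp (-f z)) x := by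
  have := isProbabilityMeasure_heatMeasure (E := E) hs
  exact integral_exp_pos ((hf.comp_add_left x).integrable_exp_neg hs)

theorem QuadConvex.exp_neg_coleHopf {f : E → ℝ} (hf : QuadConvex f) {s : ℝ} (hs : 0 ≤ s)
    (x : E) : Real.exp (-coleHopf s f x) = heatOp s (fun z => Real.exp (-f z)) x := by
  rw [coleHopf, neg_neg, Real.exp_log (hf.heatOp_exp_neg_pos hs x)]

theorem QuadConvex.quadConvex_heatOp {f : E → ℝ} (hf : QuadConvex f) {s : ℝ} (hs : 0 ≤ s) :
    QuadConvex (heatOp s f) := by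
  have := isProbabilityMeasure_heatMeasure (E := E) hs
  obtain ⟨a, b, hb, h⟩ := hf.exists_le
  have hi := fun x => (hf.comp_add_left x).integrable hs
  refine ⟨⟨convex_univ, fun x _ y _ p q hp hq hpq => ?_⟩,
    a + b * (2 * ∫ y : E, ‖y‖ ^ 2 ∂(heatMeasure E s)), b * 2, by positivity, fun x => ?_⟩
  · unfold heatOp
    rw [smul_eq_mul, smul_eq_mul, ← integral_const_mul, ← integral_const_mul,
      ← integral_add ((hi x).const_mul p) ((hi y).const_mul q)]
    refine integral_mono (hi _) (((hi x).const_mul p).add ((hi y).const_mul q)) fun z => ?_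
    have h1 := hf.convexOn.2 (mem_univ (x + z)) (mem_univ (y + z)) hp hq hpq
    have h2 : p • (x + z) + q • (y + z) = p • x + q • y + z := by
      rw [smul_add, smul_add, add_add_add_comm, ← add_smul, hpq, one_smul]
    rwa [h2] at h1
  · have h2 := (integrable_norm_sq_heatMeasure (E := E) hs).const_mul (b * 2)
    calc heatOp s f x
        ≤ ∫ y, ((a + b * 2 * ‖x‖ ^ 2) + b * 2 * ‖y‖ ^ 2) ∂(heatMeasure E s) := by
          refine integral_mono (hi x) ((integrable_const _).add h2) fun y => (h _).trans ?_
          have := mul_le_mul_of_nonneg_left (norm_add_sq_le x y) hb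
          linarith
      _ = _ := by
          rw [integral_add (integrable_const _) h2, integral_const_mul]
          simp
          ring

theorem QuadConvex.integrable_exp_neg_coleHopf {f : E → ℝ} (hf : QuadConvex f) {s t : ℝ}
    (hs : 0 ≤ s) (ht : 0 ≤ t) (x : E) :
    Integrable (fun y => Real.exp (-coleHopf t f (x + y))) (heatMeasure E s) := by
  have := isProbabilityMeasure_heatMeasure (E := E) hs
  have := isProbabilityMeasure_heatMeasure (E := E) ht
  have h1 := (hf.comp_add_left x).integrable_exp_neg (add_nonneg hs ht)
  rw [← heatMeasure_conv hs ht] at h1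
  have h2 := ((integrable_conv_iff h1.1).mp h1).2
  refine h2.congr (Eventually.of_forall fun y => ?_)
  simp only [hf.exp_neg_coleHopf ht, Real.norm_of_nonneg (Real.exp_pos _).le]
  simp only [heatOp, add_assoc]

theorem QuadConvex.coleHopf_coleHopf {f : E → ℝ} (hf : QuadConvex f) {s t : ℝ}
    (hs : 0 ≤ s) (ht : 0 ≤ t) (x : E) :
    coleHopf s (coleHopf t f) x = coleHopf (s + t) f x := by
  have := isProbabilityMeasure_heatMeasure (E := E) hs
  have := isProbabilityMeasure_heatMeasure (E := E) ht
  have h1 := (hf.comp_add_left x).integrable_exp_neg (add_nonneg hs ht)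
  rw [← heatMeasure_conv hs ht] at h1
  rw [coleHopf, coleHopf]
  simp only [hf.exp_neg_coleHopf ht]
  unfold heatOp
  rw [← heatMeasure_conv hs ht, integral_conv h1]
  simp only [add_assoc]

theorem coleHopf_mono {s : ℝ} (hs : 0 ≤ s) {f g : E → ℝ} {x : E} (h : ∀ y, f y ≤ g y)
    (hf : Integrable (fun y => Real.exp (-f (x + y))) (heatMeasure E s))
    (hg : Integrable (fun y => Real.exp (-g (x + y))) (heatMeasure E s)) :
    coleHopf s f x ≤ coleHopf s g x := by
  have := isProbabilityMeasure_heatMeasure (E := E) hs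
  exact neg_le_neg (Real.log_le_log (integral_exp_pos hg)
    (integral_mono hg hf fun y => Real.exp_le_exp.mpr (neg_le_neg (h _))))

theorem coleHopf_add_const {f : E → ℝ} {s : ℝ} {x : E} (K : ℝ)
    (hf : 0 < heatOp s (fun z => Real.exp (-f z)) x) :
    coleHopf s (fun y => f y + K) x = coleHopf s f x + K := by
  have : heatOp s (fun z => Real.exp (-(f z + K))) x
      = Real.exp (-K) * heatOp s (fun z => Real.exp (-f z)) x := by
    simp only [heatOp, neg_add, Real.exp_add]
    rw [integral_mul_const, mul_comm]
  rw [coleHopf, coleHopf, this, Real.log_mul (Real.exp_pos _).ne' hf.ne', Real.log_exp]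
  ring

/-! ### One step of the splitting scheme against the Cole–Hopf semigroup -/

/-- One step of the splitting scheme lies below the Cole–Hopf semigroup; this is Talagrand's
inequality in dual form. -/
theorem QuadConvex.heatOp_infConv_le {f : E → ℝ} (hf : QuadConvex f) {s : ℝ} (hs : 0 < s)
    (x : E) : heatOp s (infConv s f) x ≤ coleHopf s f x := by
  have hq := (hf.quadConvex_infConv hs).comp_add_left x
  have hx := hf.comp_add_left x
  have key := lintegral_exp_neg_le hs hq.continuous.measurable hx.continuous.measurable
    (hq.integrable hs.le) fun z y => by
      have := hf.infConv_le_add hs (x + z) (y - z)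
      rwa [add_add_sub_cancel, ← norm_neg, neg_sub] at this
  rw [← ofReal_integral_eq_lintegral_ofReal (hx.integrable_exp_neg hs.le)
    (Eventually.of_forall fun y => (Real.exp_pos _).le),
    ENNReal.ofReal_le_ofReal_iff (Real.exp_pos _).le] at key
  have h2 := Real.log_le_log (hf.heatOp_exp_neg_pos hs.le x) key
  rw [Real.log_exp] at h2
  exact le_neg_of_le_neg h2

/-- The steps taken in the other order lie above the Cole–Hopf semigroup: shift the Gaussian
measure by the competitor in the infimum and apply Jensen's inequality. -/
theorem QuadConvex.coleHopf_le {f : E → ℝ} (hf : QuadConvex f) {s : ℝ} (hs : 0 < s)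
    (x : E) : coleHopf s f x ≤ infConv s (heatOp s f) x := by
  have := isProbabilityMeasure_heatMeasure (E := E) hs.le
  refine le_ciInf fun y => ?_
  have hxy := hf.comp_add_left (x + y)
  set g : E → ℝ := fun z => (inner ℝ (-y) z / s - ‖-y‖ ^ 2 / (2 * s)) + -f (x + y + z) with hg
  have e1 : heatOp s (fun z => Real.exp (-f z)) x
      = ∫ z, Real.exp (g z) ∂(heatMeasure E s) := by
    have := integral_add_heatMeasure hs (fun z => Real.exp (-f (x + y + z))) (-y)
    simp only [hg, Real.exp_add]
    rw [← this]
    simp [heatOp, add_assoc]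
  have hin : Integrable (fun z : E => (inner ℝ (-y) z / s : ℝ)) (heatMeasure E s) := by
    refine integrable_heatMeasure_of_le hs.le (by fun_prop) (A := ‖y‖ / s) (B := ‖y‖ / s)
      fun z => ?_
    rw [abs_div, abs_of_pos hs, div_mul_eq_mul_div, ← add_div]
    gcongr
    have := abs_real_inner_le_norm (-y) z
    rw [norm_neg] at this
    nlinarith [norm_nonneg y, mul_nonneg (norm_nonneg y) (sq_nonneg (‖z‖ - 1)),
      mul_nonneg (norm_nonneg y) (sq_nonneg (‖z‖)), mul_nonneg (norm_nonneg y) (norm_nonneg z)]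
  have hgi : Integrable g (heatMeasure E s) :=
    (hin.sub (integrable_const _)).add (hxy.integrable hs.le).neg
  have e2 : ∫ z, g z ∂(heatMeasure E s) = -(‖y‖ ^ 2 / (2 * s)) - heatOp s f (x + y) := by
    have h1 : ∫ z, g z ∂(heatMeasure E s)
        = (∫ z, inner ℝ (-y) z / s ∂(heatMeasure E s)
          - ∫ _, ‖-y‖ ^ 2 / (2 * s) ∂(heatMeasure E s))
          + ∫ z, -f (x + y + z) ∂(heatMeasure E s) := by
      rw [← integral_sub hin (integrable_const _)]
      exact integral_add (hin.sub (integrable_const _)) (hxy.integrable hs.le).neg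
    rw [h1, integral_div, integral_inner_heatMeasure hs.le, integral_neg]
    simp [heatOp]
    ring
  have hexp : Integrable (fun z => Real.exp (g z)) (heatMeasure E s) := by
    obtain ⟨A, B, hB, h⟩ := hxy.exists_neg_norm_le
    refine integrable_exp_heatMeasure (A := A) (B := B + ‖y‖ / s)
      (by have := hf.continuous; fun_prop) (fun z => ?_) hs.le
    have h1 := (abs_le.mp (abs_real_inner_le_norm (-y) z)).2
    rw [norm_neg] at h1
    have h2 : (inner ℝ (-y) z : ℝ) / s ≤ ‖y‖ / s * ‖z‖ := by
      rw [div_mul_eq_mul_div]; gcongr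
    have h3 : 0 ≤ ‖-y‖ ^ 2 / (2 * s) := by positivity
    have := h z
    simp only [hg]
    linarith
  have key := ofReal_exp_integral_le hgi
  rw [← ofReal_integral_eq_lintegral_ofReal hexp
    (Eventually.of_forall fun y => (Real.exp_pos _).le),
    ENNReal.ofReal_le_ofReal_iff (integral_nonneg fun z => (Real.exp_pos _).le), ← e1, e2] at key
  have h2 := Real.log_le_log (Real.exp_pos _) key
  rw [Real.log_exp] at h2
  rw [coleHopf]
  linarith

/-- The second moment of the standard Gaussian measure. -/
def gaussianMoment (E : Type*) [NormedAddCommGroup E] [InnerProductSpace ℝ E]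
    [FiniteDimensional ℝ E] [MeasurableSpace E] [BorelSpace E] : ℝ :=
  ∫ y, ‖y‖ ^ 2 ∂(heatMeasure E 1)

/-- The heat semigroup increases a semiconcave function at most linearly in time. -/
theorem QuadConvex.heatOp_le_of_concaveOn {f : E → ℝ} (hf : QuadConvex f) {k : ℝ}
    (hk : ConcaveOn ℝ univ fun x => f x - k / 2 * ‖x‖ ^ 2) {s : ℝ} (hs : 0 ≤ s) (x : E) :
    heatOp s f x ≤ f x + k / 2 * gaussianMoment E * s := by
  have := isProbabilityMeasure_heatMeasure (E := E) hs
  have hi := (hf.comp_add_left x).integrable hs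
  have hi' : Integrable (fun y => f (x + -y)) (heatMeasure E s) := by
    rw [← heatMeasure_map_neg hs] at hi
    exact hi.comp_measurable measurable_neg
  have hsymm : heatOp s f x
      = ∫ y, (1 / 2 * (f (x + y) + f (x + -y))) ∂(heatMeasure E s) := by
    rw [integral_const_mul, integral_add hi hi',
      integral_comp_neg_heatMeasure hs fun y => f (x + y), heatOp]
    ring
  have h2 := (integrable_norm_sq_heatMeasure (E := E) hs).const_mul (k / 2)
  calc heatOp s f x
      ≤ ∫ y, (f x + k / 2 * ‖y‖ ^ 2) ∂(heatMeasure E s) := by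
        rw [hsymm]
        refine integral_mono ((hi.add hi').const_mul _) ((integrable_const _).add h2) fun y => ?_
        have h1 := hk.2 (mem_univ (x + y)) (mem_univ (x + -y)) (by norm_num : (0 : ℝ) ≤ 1 / 2)
          (by norm_num : (0 : ℝ) ≤ 1 / 2) (by norm_num)
        have h3 : (1 / 2 : ℝ) • (x + y) + (1 / 2 : ℝ) • (x + -y) = x := by
          rw [← smul_add, add_add_add_comm, add_neg_cancel, add_zero, ← two_smul ℝ x, smul_smul]
          norm_num
        have h4 := parallelogram_law_with_norm ℝ x y
        rw [h3] at h1
        rw [sub_eq_add_neg x y] at h4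
        simp only [smul_eq_mul] at h1 ⊢
        have h5 := congrArg (fun r => k / 4 * r) h4
        nlinarith
    _ = _ := by
        rw [integral_add (integrable_const _) h2, integral_const_mul,
          integral_norm_sq_heatMeasure hs, gaussianMoment]
        simp
        ring

/-! ### The splitting scheme against the Cole–Hopf semigroup -/

/-- `n` steps of the splitting scheme with step size `s`. -/
def splitOp (s : ℝ) (n : ℕ) (f : E → ℝ) : E → ℝ :=
  (fun g => heatOp s (infConv s g))^[n] f

theorem splitOp_succ (s : ℝ) (n : ℕ) (f : E → ℝ) :
    splitOp s (n + 1) f = heatOp s (infConv s (splitOp s n f)) :=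
  Function.iterate_succ_apply' _ _ _

theorem QuadConvex.quadConvex_splitOp {f : E → ℝ} (hf : QuadConvex f) {s : ℝ} (hs : 0 < s) (n : ℕ) :
    QuadConvex (splitOp s n f) := by
  induction n with
  | zero => exact hf
  | succ n ih => rw [splitOp_succ]; exact (ih.quadConvex_infConv hs).quadConvex_heatOp hs.le

theorem QuadConvex.splitOp_le {f : E → ℝ} (hf : QuadConvex f) {s : ℝ} (hs : 0 < s) (n : ℕ)
    (x : E) : splitOp s n f x ≤ coleHopf (n * s) f x := by
  induction n generalizing x with
  | zero => simp [splitOp, coleHopf, heatOp]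
  | succ n ih =>
    have hn : 0 ≤ (n : ℝ) * s := by positivity
    rw [splitOp_succ]
    refine ((hf.quadConvex_splitOp hs n).heatOp_infConv_le hs x).trans ?_
    refine (coleHopf_mono hs.le ih
      (((hf.quadConvex_splitOp hs n).comp_add_left x).integrable_exp_neg hs.le)
      (hf.integrable_exp_neg_coleHopf hs.le hn x)).trans_eq ?_
    rw [hf.coleHopf_coleHopf hs.le hn]
    congr 1; push_cast; ring

/-- With `P` and `Q` for the two half steps, `V_{(n+1)s} f ≤ (Q P)^(n+1) f = Q (P Q)^n P f`. Here
`P f ≤ f + K s` by semiconcavity, and the outer `Q` only decreases the function. -/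
theorem QuadConvex.coleHopf_le_splitOp {f : E → ℝ} (hf : QuadConvex f) {k : ℝ}
    (hk : ConcaveOn ℝ univ fun x => f x - k / 2 * ‖x‖ ^ 2) {s : ℝ} (hs : 0 < s) (n : ℕ) (x : E) :
    coleHopf ((n + 1) * s) f x ≤ splitOp s n f x + k / 2 * gaussianMoment E * s := by
  set K := k / 2 * gaussianMoment E * s with hK
  suffices h : ∀ x, coleHopf ((n + 1) * s) f x
      ≤ infConv s (splitOp s n f) x + K by
    have := (hf.quadConvex_splitOp hs n).infConv_le hs x
    linarith [h x]
  clear x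
  induction n with
  | zero =>
    intro x
    rw [Nat.cast_zero, zero_add, one_mul]
    exact (hf.coleHopf_le hs x).trans
      (infConv_mono_add (hf.quadConvex_heatOp hs.le) hs (hf.heatOp_le_of_concaveOn hk hs.le) x)
  | succ n ih =>
    intro x
    have hn : 0 ≤ ((n : ℝ) + 1) * s := by positivity
    have hq := (hf.quadConvex_splitOp hs n).quadConvex_infConv hs
    have e : ((n + 1 : ℕ) + 1 : ℝ) * s = s + (n + 1) * s := by push_cast; ring
    rw [e, ← hf.coleHopf_coleHopf hs.le hn, splitOp_succ]
    have hqK : Integrable (fun y => Real.exp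
        (-(infConv s (splitOp s n f) (x + y) + K))) (heatMeasure E s) := by
      simp only [neg_add, Real.exp_add]
      exact ((hq.comp_add_left x).integrable_exp_neg hs.le).mul_const _
    refine (coleHopf_mono hs.le ih (hf.integrable_exp_neg_coleHopf hs.le hn x) hqK).trans ?_
    rw [coleHopf_add_const K (hq.heatOp_exp_neg_pos hs.le x)]
    have := hq.coleHopf_le hs x
    linarith

end FiniteDimensional

end Operators

/-! ### Smoothness of Laplace transforms -/

section Laplace

variable {Z P G : Type} [MeasurableSpace Z] {μ : Measure Z} [NormedAddCommGroup P]
  [NormedSpace ℝ P] [NormedAddCommGroup G] [NormedSpace ℝ G] {T : Z → P →L[ℝ] ℝ} {U : Set P}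

/-- The Laplace transform `ξ ↦ ∫ exp (T z ξ) g z dμ(z)` of a vector-valued density `g`, with
linear functionals `T z` in the exponent. -/
def laplaceTransform (μ : Measure Z) (T : Z → P →L[ℝ] ℝ) (g : Z → G) (ξ : P) : G :=
  ∫ z, Real.exp (T z ξ) • g z ∂μ

/-- The Laplace transform of `g` converges on `U`, with an exponential moment to spare at each
point. -/
structure LaplaceIntegrable (μ : Measure Z) (T : Z → P →L[ℝ] ℝ) (U : Set P) (g : Z → G) :
    Prop where
  aestronglyMeasurable : AEStronglyMeasurable g μ
  exists_integrable : ∀ ξ ∈ U, ∃ ε : ℝ, 0 < ε ∧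
    Integrable (fun z => Real.exp (T z ξ + ε * ‖T z‖) * ‖g z‖) μ

/-- Differentiating the transform multiplies the density by `T`; half of the spare exponential
moment pays for this factor. -/
theorem LaplaceIntegrable.smulRight {g : Z → G} (hT : AEStronglyMeasurable T μ)
    (hg : LaplaceIntegrable μ T U g) :
    LaplaceIntegrable μ T U fun z => (T z).smulRight (g z) := by
  have hm : AEStronglyMeasurable (fun z => (T z).smulRight (g z)) μ :=
    Continuous.comp_aestronglyMeasurable
      (g := fun p : (P →L[ℝ] ℝ) × G => p.1.smulRight p.2) (by fun_prop)
      (hT.prodMk hg.aestronglyMeasurable)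
  refine ⟨hm, fun ξ hξ => ?_⟩
  obtain ⟨ε, hε, hi⟩ := hg.exists_integrable ξ hξ
  refine ⟨ε / 2, half_pos hε, (hi.const_mul (2 / ε)).mono' ?_ (Eventually.of_forall fun z => ?_)⟩
  · exact (Real.continuous_exp.comp_aestronglyMeasurable
      ((hT.apply_continuousLinearMap ξ).add (hT.norm.const_mul _))).mul hm.norm
  · rw [Real.norm_of_nonneg (by positivity), ContinuousLinearMap.norm_smulRight_apply]
    have h1 : ε / 2 * ‖T z‖ ≤ Real.exp (ε / 2 * ‖T z‖) :=
      (le_add_of_nonneg_right zero_le_one).trans (Real.add_one_le_exp _)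
    have h2 : ‖T z‖ ≤ 2 / ε * Real.exp (ε / 2 * ‖T z‖) := by
      rw [div_mul_eq_mul_div, le_div_iff₀ hε]
      linarith
    have h3 : Real.exp (T z ξ + ε * ‖T z‖)
        = Real.exp (T z ξ + ε / 2 * ‖T z‖) * Real.exp (ε / 2 * ‖T z‖) := by
      rw [← Real.exp_add]; congr 1; ring
    rw [h3]
    calc Real.exp (T z ξ + ε / 2 * ‖T z‖) * (‖T z‖ * ‖g z‖)
        ≤ Real.exp (T z ξ + ε / 2 * ‖T z‖) *
          ((2 / ε * Real.exp (ε / 2 * ‖T z‖)) * ‖g z‖) := by gcongr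
      _ = _ := by ring

theorem LaplaceIntegrable.integrable {g : Z → G} (hT : AEStronglyMeasurable T μ)
    (hg : LaplaceIntegrable μ T U g) {ξ : P} (hξ : ξ ∈ U) :
    Integrable (fun z => Real.exp (T z ξ) • g z) μ := by
  obtain ⟨ε, hε, hi⟩ := hg.exists_integrable ξ hξ
  refine hi.mono' ((Real.continuous_exp.comp_aestronglyMeasurable
    (hT.apply_continuousLinearMap ξ)).smul hg.aestronglyMeasurable)
    (Eventually.of_forall fun z => ?_)
  rw [norm_smul, Real.norm_of_nonneg (Real.exp_pos _).le]
  gcongr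
  have : 0 ≤ ε * ‖T z‖ := by positivity
  linarith

theorem LaplaceIntegrable.hasFDerivAt {g : Z → G} (hT : AEStronglyMeasurable T μ)
    (hg : LaplaceIntegrable μ T U g) {ξ : P} (hξ : ξ ∈ U) :
    HasFDerivAt (laplaceTransform μ T g)
      (laplaceTransform μ T (fun z => (T z).smulRight (g z)) ξ) ξ := by
  have hg' := hg.smulRight hT
  obtain ⟨ε, hε, hi⟩ := hg'.exists_integrable ξ hξ
  refine hasFDerivAt_integral_of_dominated_of_fderiv_le
    (F' := fun ξ z => Real.exp (T z ξ) • (T z).smulRight (g z)) (Metric.ball_mem_nhds ξ hε)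
    (Eventually.of_forall fun ξ' => (Real.continuous_exp.comp_aestronglyMeasurable
      (hT.apply_continuousLinearMap ξ')).smul hg.aestronglyMeasurable)
    (hg.integrable hT hξ) ((hg'.integrable hT hξ).1) (Eventually.of_forall fun z ξ' hξ' => ?_) hi
    (Eventually.of_forall fun z ξ' _ => ?_)
  · rw [norm_smul, Real.norm_of_nonneg (Real.exp_pos _).le]
    gcongr
    have h1 : T z ξ' = T z ξ + T z (ξ' - ξ) := by rw [map_sub]; ring
    have h2 := (le_abs_self _).trans ((T z).le_opNorm (ξ' - ξ))
    rw [Metric.mem_ball, dist_eq_norm] at hξ'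
    rw [h1]
    have := mul_le_mul_of_nonneg_left hξ'.le (norm_nonneg (T z))
    linarith
  · have h1 := ((T z).hasFDerivAt (x := ξ')).exp.smul_const (g z)
    convert h1 using 1
    ext p
    simp [smul_smul]

theorem LaplaceIntegrable.contDiffOn_nat (hT : AEStronglyMeasurable T μ) (hU : IsOpen U) (n : ℕ) :
    ∀ {G : Type} [NormedAddCommGroup G] [NormedSpace ℝ G] {g : Z → G},
      LaplaceIntegrable μ T U g → ContDiffOn ℝ n (laplaceTransform μ T g) U := by
  induction n with
  | zero =>
    intro G _ _ g hg
    exact contDiffOn_zero.mpr fun ξ hξ => (hg.hasFDerivAt hT hξ).continuousAt.continuousWithinAt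
  | succ n ih =>
    intro G _ _ g hg
    rw [Nat.cast_succ, contDiffOn_succ_iff_hasFDerivWithinAt_of_uniqueDiffOn hU.uniqueDiffOn]
    exact ⟨by simp, _, ih (hg.smulRight hT),
      fun ξ hξ => (hg.hasFDerivAt hT hξ).hasFDerivWithinAt⟩

theorem LaplaceIntegrable.contDiffOn {g : Z → G} (hT : AEStronglyMeasurable T μ) (hU : IsOpen U)
    (hg : LaplaceIntegrable μ T U g) : ContDiffOn ℝ (⊤ : ℕ∞) (laplaceTransform μ T g) U :=
  contDiffOn_infty.mpr fun n => LaplaceIntegrable.contDiffOn_nat hT hU n hg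

theorem LaplaceIntegrable.apply_smul {g : Z → G} (hT : AEStronglyMeasurable T μ)
    (hg : LaplaceIntegrable μ T U g) (p : P) :
    LaplaceIntegrable μ T U fun z => T z p • g z := by
  have hg' := hg.smulRight hT
  have hm : AEStronglyMeasurable (fun z => T z p • g z) μ :=
    (hT.apply_continuousLinearMap p).smul hg.aestronglyMeasurable
  refine ⟨hm, fun ξ hξ => ?_⟩
  obtain ⟨ε, hε, hi⟩ := hg'.exists_integrable ξ hξ
  refine ⟨ε, hε, (hi.const_mul ‖p‖).mono' ?_ (Eventually.of_forall fun z => ?_)⟩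
  · exact (Real.continuous_exp.comp_aestronglyMeasurable
      ((hT.apply_continuousLinearMap ξ).add (hT.norm.const_mul _))).mul hm.norm
  · rw [Real.norm_of_nonneg (by positivity), mul_left_comm]
    gcongr
    have := ((T z).smulRight (g z)).le_opNorm p
    rw [mul_comm]
    simpa using this

theorem LaplaceIntegrable.hasDerivAt [CompleteSpace G] {g : Z → G}
    (hT : AEStronglyMeasurable T μ)
    (hg : LaplaceIntegrable μ T U g) {c : ℝ → P} {c' : P} {r : ℝ} (hc : HasDerivAt c c' r)
    (hr : c r ∈ U) : HasDerivAt (fun r => laplaceTransform μ T g (c r))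
      (laplaceTransform μ T (fun z => T z c' • g z) (c r)) r := by
  have h := (hg.hasFDerivAt hT hr).comp_hasDerivAt r hc
  refine h.congr_deriv ?_
  unfold laplaceTransform
  rw [ContinuousLinearMap.integral_apply ((hg.smulRight hT).integrable hT hr)]
  rfl

end Laplace

/-! ### The viscous Hamilton–Jacobi equation -/

section Equation

section Lines

variable {E : Type*} [NormedAddCommGroup E] [InnerProductSpace ℝ E]

theorem hasDerivAt_line (x e : E) (r : ℝ) : HasDerivAt (fun r : ℝ => x + r • e) e r := by
  simpa using ((hasDerivAt_id r).smul_const e).const_add x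

theorem fderiv_apply_eq_of_line {f : E → ℝ} (hf : Differentiable ℝ f) {x e : E} {r d : ℝ}
    (h : HasDerivAt (fun r : ℝ => f (x + r • e)) d r) : d = fderiv ℝ f (x + r • e) e :=
  h.unique ((hf _).hasFDerivAt.comp_hasDerivAt r (hasDerivAt_line x e r))

variable [FiniteDimensional ℝ E] {ι : Type*} [Fintype ι]

/-- The norm of the gradient from the directional derivatives along an orthonormal basis. -/
theorem norm_gradient_sq_of_lines (b : OrthonormalBasis ι ℝ E) {f : E → ℝ}
    (hf : Differentiable ℝ f) (x : E) {d : ι → ℝ}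
    (h : ∀ i, HasDerivAt (fun r : ℝ => f (x + r • b i)) (d i) 0) :
    ‖gradient f x‖ ^ 2 = ∑ i, d i ^ 2 := by
  rw [← b.sum_sq_inner_left]
  refine Finset.sum_congr rfl fun i _ => ?_
  rw [fderiv_apply_eq_of_line hf (h i), zero_smul, add_zero, gradient,
    InnerProductSpace.toDual_symm_apply]

/-- The Laplacian from the second derivatives along the lines in the directions of an
orthonormal basis. -/
theorem laplacian_of_lines (b : OrthonormalBasis ι ℝ E) {f : E → ℝ} (hf : ContDiff ℝ 2 f) (x : E)
    {f₁ : ι → ℝ → ℝ} {f₂ : ι → ℝ}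
    (h₁ : ∀ i r, HasDerivAt (fun r : ℝ => f (x + r • b i)) (f₁ i r) r)
    (h₂ : ∀ i, HasDerivAt (f₁ i) (f₂ i) 0) : Laplacian.laplacian f x = ∑ i, f₂ i := by
  rw [InnerProductSpace.laplacian_eq_iteratedFDeriv_orthonormalBasis f b]
  refine Finset.sum_congr rfl fun i _ => ?_
  have hd : Differentiable ℝ (fderiv ℝ f) :=
    (hf.fderiv_right (m := 1) (by norm_num)).differentiable (by norm_num)
  have h3 : HasDerivAt (fun r : ℝ => fderiv ℝ f (x + r • b i))
      (fderiv ℝ (fderiv ℝ f) (x + (0 : ℝ) • b i) (b i)) 0 :=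
    (hd _).hasFDerivAt.comp_hasDerivAt (0 : ℝ) (hasDerivAt_line x (b i) 0)
  have h4 := (ContinuousLinearMap.apply ℝ ℝ (b i)).hasFDerivAt.comp_hasDerivAt (0 : ℝ) h3
  have h5 : f₁ i = fun r => fderiv ℝ f (x + r • b i) (b i) := funext fun r =>
    fderiv_apply_eq_of_line (hf.differentiable (by norm_num)) (h₁ i r)
  have h6 : f₂ i = fderiv ℝ (fderiv ℝ f) (x + (0 : ℝ) • b i) (b i) (b i) :=
    (h5 ▸ h₂ i).unique h4
  rw [iteratedFDeriv_two_apply, h6]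
  simp

end Lines

variable {E : Type} [NormedAddCommGroup E] [InnerProductSpace ℝ E]

/-- The linear functional `(θ, η) ↦ ⟪z, θ⟫ - ‖z‖² η`, the exponent of the Gaussian kernel. -/
def gaussianExponent (z : E) : E × ℝ →L[ℝ] ℝ :=
  (innerSL ℝ z).comp (ContinuousLinearMap.fst ℝ E ℝ) -
    (‖z‖ ^ 2) • ContinuousLinearMap.snd ℝ E ℝ

@[simp] theorem gaussianExponent_apply (z θ : E) (η : ℝ) :
    gaussianExponent z (θ, η) = inner ℝ z θ - ‖z‖ ^ 2 * η := by
  simp [gaussianExponent]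

theorem continuous_gaussianExponent : Continuous (gaussianExponent : E → E × ℝ →L[ℝ] ℝ) := by
  unfold gaussianExponent
  fun_prop

theorem norm_gaussianExponent_le (z : E) : ‖gaussianExponent z‖ ≤ ‖z‖ + ‖z‖ ^ 2 := by
  refine ContinuousLinearMap.opNorm_le_bound _ (by positivity) fun p => ?_
  obtain ⟨θ, η⟩ := p
  rw [gaussianExponent_apply, add_mul]
  refine (norm_sub_le _ _).trans (add_le_add ?_ ?_)
  · exact (norm_inner_le_norm z θ).trans (by gcongr; exact norm_fst_le (θ, η))
  · rw [norm_mul, Real.norm_of_nonneg (sq_nonneg ‖z‖)]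
    gcongr; exact norm_snd_le (θ, η)

variable [FiniteDimensional ℝ E] [MeasurableSpace E] [BorelSpace E]

theorem QuadConvex.laplaceIntegrable {f : E → ℝ} (hf : QuadConvex f) :
    LaplaceIntegrable (volume : Measure E) gaussianExponent {p : E × ℝ | 0 < p.2}
      fun z => Real.exp (-f z) := by
  have hc := hf.continuous
  refine ⟨(by fun_prop : Continuous _).aestronglyMeasurable, ?_⟩
  rintro ⟨θ, η⟩ (hη : 0 < η)
  obtain ⟨A, B, hB, h⟩ := hf.exists_neg_norm_le
  refine ⟨η / 2, half_pos hη, ((integrable_exp_neg_mul_sq_add (E := E) (half_pos hη)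
    (‖θ‖ + η / 2 + B)).const_mul (Real.exp A)).mono' ?_ (Eventually.of_forall fun z => ?_)⟩
  · have := continuous_gaussianExponent (E := E)
    exact (by fun_prop : Continuous _).aestronglyMeasurable
  · rw [Real.norm_of_nonneg (Real.exp_pos _).le, Real.norm_of_nonneg (by positivity),
      ← Real.exp_add, ← Real.exp_add, Real.exp_le_exp, gaussianExponent_apply]
    have h1 := mul_le_mul_of_nonneg_left (norm_gaussianExponent_le z) (half_pos hη).le
    have h2 := real_inner_le_norm z θ
    have := h z
    linarith

/-- The Laplace transform of the density `g exp (-f)` for the exponent `gaussianExponent`; the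
factor `g` serves to take moments. -/
def gaussianLaplace (f g : E → ℝ) (p : E × ℝ) : ℝ :=
  laplaceTransform (volume : Measure E) gaussianExponent (fun z => g z * Real.exp (-f z)) p

theorem gaussianLaplace_one_pos {f : E → ℝ} (hf : QuadConvex f) {p : E × ℝ} (hp : 0 < p.2) :
    0 < gaussianLaplace f (fun _ => 1) p := by
  have h := hf.laplaceIntegrable.integrable
    continuous_gaussianExponent.aestronglyMeasurable (ξ := p) hp
  simp only [smul_eq_mul, ← Real.exp_add] at h
  simpa only [gaussianLaplace, laplaceTransform, one_mul, smul_eq_mul, ← Real.exp_add]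
    using integral_exp_pos h

/-- Expanding the square in the heat kernel expresses the heat semigroup through the Laplace
transform at the point `(x / s, 1 / (2s))`. -/
theorem heatOp_exp_neg_eq (f : E → ℝ) {s : ℝ} (hs : 0 < s) (x : E) :
    heatOp s (fun z => Real.exp (-f z)) x
      = (∫ y : E, gaussianWeight s y)⁻¹ * (Real.exp (-(‖x‖ ^ 2 / (2 * s))) *
        gaussianLaplace f (fun _ => 1) (s⁻¹ • x, (2 * s)⁻¹)) := by
  rw [heatOp, integral_heatMeasure hs, smul_eq_mul, gaussianLaplace, laplaceTransform,
    ← integral_const_mul (Real.exp (-(‖x‖ ^ 2 / (2 * s)))),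
    ← integral_add_left_eq_self (fun y => gaussianWeight s y • Real.exp (-f (x + y))) (-x)]
  congr 2; ext z
  simp only [gaussianWeight, smul_eq_mul, add_neg_cancel_left, one_mul, gaussianExponent_apply,
    ← Real.exp_add]
  congr 1
  rw [neg_add_eq_sub x z, norm_sub_sq_real, inner_smul_right]
  field_simp
  ring

theorem coleHopf_eq {f : E → ℝ} (hf : QuadConvex f) {s : ℝ} (hs : 0 < s) (x : E) :
    coleHopf s f x = Module.finrank ℝ E / 2 * Real.log (2 * Real.pi * s) + ‖x‖ ^ 2 / (2 * s)
      - Real.log (gaussianLaplace f (fun _ => 1) (s⁻¹ • x, (2 * s)⁻¹)) := by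
  have h1 := gaussianLaplace_one_pos hf (p := (s⁻¹ • x, (2 * s)⁻¹)) (by simpa using hs)
  have h2 := integral_gaussianWeight_pos (E := E) hs
  rw [coleHopf, heatOp_exp_neg_eq f hs, Real.log_mul (inv_ne_zero h2.ne') (by positivity),
    Real.log_mul (Real.exp_pos _).ne' h1.ne', Real.log_exp, Real.log_inv,
    integral_gaussianWeight hs, Real.log_rpow (by positivity)]
  ring

theorem contDiffOn_gaussianLaplace {f : E → ℝ} (hf : QuadConvex f) :
    ContDiffOn ℝ (⊤ : ℕ∞) (gaussianLaplace f fun _ => 1) {p : E × ℝ | 0 < p.2} := by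
  have := hf.laplaceIntegrable.contDiffOn continuous_gaussianExponent.aestronglyMeasurable
    (isOpen_lt continuous_const continuous_snd)
  refine this.congr fun p _ => ?_
  simp only [gaussianLaplace, one_mul]

theorem QuadConvex.contDiffOn_coleHopf {f : E → ℝ} (hf : QuadConvex f) :
    ContDiffOn ℝ (⊤ : ℕ∞) (fun p : E × ℝ => coleHopf p.2 f p.1) (univ ×ˢ Ioi 0) := by
  have hpos : ∀ p ∈ (univ ×ˢ Ioi 0 : Set (E × ℝ)), (0 : ℝ) < p.2 := fun p hp => hp.2
  have hG : ContDiffOn ℝ (⊤ : ℕ∞) (fun p : E × ℝ =>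
      gaussianLaplace f (fun _ => 1) (p.2⁻¹ • p.1, (2 * p.2)⁻¹)) (univ ×ˢ Ioi 0) := by
    refine (contDiffOn_gaussianLaplace hf).comp (g := gaussianLaplace f fun _ => 1)
      (f := fun p : E × ℝ => (p.2⁻¹ • p.1, (2 * p.2)⁻¹)) (ContDiffOn.prodMk ?_ ?_) ?_
    · exact (contDiffOn_snd.inv fun p hp => (hpos p hp).ne').smul contDiffOn_fst
    · exact (contDiffOn_const.mul contDiffOn_snd).inv fun p hp => by
        have := hpos p hp; positivity
    · intro p hp
      have := hpos p hp
      simpa using this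
  have hfin : ContDiffOn ℝ (⊤ : ℕ∞) (fun p : E × ℝ =>
      Module.finrank ℝ E / 2 * Real.log (2 * Real.pi * p.2) + ‖p.1‖ ^ 2 / (2 * p.2)
      - Real.log (gaussianLaplace f (fun _ => 1) (p.2⁻¹ • p.1, (2 * p.2)⁻¹)))
      (univ ×ˢ Ioi 0) := by
    refine ContDiffOn.sub (ContDiffOn.add (contDiffOn_const.mul (ContDiffOn.log
      (contDiffOn_const.mul contDiffOn_snd) fun p hp => ?_)) (ContDiffOn.div
      (contDiffOn_fst.norm_sq ℝ) (contDiffOn_const.mul contDiffOn_snd) fun p hp => ?_))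
      (hG.log fun p hp => ?_) <;> have := hpos p hp
    · positivity
    · positivity
    · exact (gaussianLaplace_one_pos hf (by simpa using this)).ne'
  exact hfin.congr fun p hp => coleHopf_eq hf (hpos p hp) p.1

theorem QuadConvex.contDiff_coleHopf {f : E → ℝ} (hf : QuadConvex f) {s : ℝ} (hs : 0 < s) :
    ContDiff ℝ (⊤ : ℕ∞) (coleHopf s f) := by
  have h : ContDiffOn ℝ (⊤ : ℕ∞) (fun x : E => (x, s)) univ := by fun_prop
  exact contDiffOn_univ.mp (hf.contDiffOn_coleHopf.comp h fun x _ => ⟨mem_univ _, hs⟩)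

/-- The Cole–Hopf semigroup solves the viscous Hamilton–Jacobi equation. All derivatives are
moments `Λ g = ∫ g exp (-f + ⟪·, x⟫ / s - ‖·‖² / (2s))`, and the squared first moments in the
Laplacian and in the squared gradient cancel. -/
theorem QuadConvex.hasDerivAt_coleHopf {f : E → ℝ} (hf : QuadConvex f) {s : ℝ} (hs : 0 < s)
    (x : E) :
    HasDerivAt (fun r => coleHopf r f x)
      (1 / 2 * Laplacian.laplacian (coleHopf s f) x - 1 / 2 * ‖gradient (coleHopf s f) x‖ ^ 2)
      s := by
  have hT := (continuous_gaussianExponent (E := E)).aestronglyMeasurable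
    (μ := (volume : Measure E))
  set Λ : (E → ℝ) → E → ℝ := fun g y => gaussianLaplace f g (s⁻¹ • y, (2 * s)⁻¹) with hΛ
  have hpt : ∀ y : E, (s⁻¹ • y, (2 * s)⁻¹) ∈ {p : E × ℝ | 0 < p.2} := fun y => by
    simpa using hs
  have h1pos : ∀ y, 0 < Λ (fun _ => 1) y := fun y => gaussianLaplace_one_pos hf (hpt y)
  have hL1 : LaplaceIntegrable (volume : Measure E) gaussianExponent {p : E × ℝ | 0 < p.2}
      fun z => 1 * Real.exp (-f z) := by simpa only [one_mul] using hf.laplaceIntegrable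
  have hLe : ∀ e : E, LaplaceIntegrable (volume : Measure E) gaussianExponent
      {p : E × ℝ | 0 < p.2} fun z => inner ℝ z e * Real.exp (-f z) := fun e => by
    simpa using hf.laplaceIntegrable.apply_smul hT (e, 0)
  -- Integrability of the density with quadratic factors, needed to add up the second moments.
  have hLee : ∀ e : E, Integrable (fun z => Real.exp (gaussianExponent z (s⁻¹ • x, (2 * s)⁻¹)) •
      ((inner ℝ z e) ^ 2 * Real.exp (-f z))) := fun e => by
    have := ((hLe e).apply_smul hT (e, 0)).integrable hT (hpt x)
    refine this.congr (Eventually.of_forall fun z => ?_)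
    simp only [gaussianExponent_apply, mul_zero, sub_zero, smul_eq_mul]
    ring
  have hsq : Integrable (fun z => Real.exp (gaussianExponent z (s⁻¹ • x, (2 * s)⁻¹)) •
      (‖z‖ ^ 2 * Real.exp (-f z))) := by
    have := (hf.laplaceIntegrable.apply_smul hT (0, -1)).integrable hT (hpt x)
    simpa using this
  set b := stdOrthonormalBasis ℝ E
  have hline : ∀ (e : E) (r : ℝ), HasDerivAt (fun r : ℝ => (s⁻¹ • (x + r • e), (2 * s)⁻¹))
      ((s⁻¹ • e, 0) : E × ℝ) r := fun e r => by
    have h := (((hasDerivAt_id r).smul_const e).const_add x).const_smul s⁻¹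
    simpa using h.prodMk (hasDerivAt_const r ((2 * s)⁻¹))
  have hΛ1 : ∀ (e : E) (r : ℝ), HasDerivAt (fun r : ℝ => Λ (fun _ => 1) (x + r • e))
      (s⁻¹ * Λ (fun z => inner ℝ z e) (x + r • e)) r := fun e r => by
    refine (hL1.hasDerivAt hT (hline e r) (hpt _)).congr_deriv ?_
    simp only [hΛ, gaussianLaplace, laplaceTransform]
    rw [← integral_const_mul]
    congr 1; ext z
    simp [inner_smul_right]
    ring
  have hΛ2 : ∀ (e : E) (r : ℝ), HasDerivAt (fun r : ℝ => Λ (fun z => inner ℝ z e) (x + r • e))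
      (s⁻¹ * Λ (fun z => (inner ℝ z e) ^ 2) (x + r • e)) r := fun e r => by
    refine ((hLe e).hasDerivAt hT (hline e r) (hpt _)).congr_deriv ?_
    simp only [hΛ, gaussianLaplace, laplaceTransform]
    rw [← integral_const_mul]
    congr 1; ext z
    simp [inner_smul_right]
    ring
  have hnorm : ∀ (e : E) (r : ℝ), HasDerivAt (fun r : ℝ => ‖x + r • e‖ ^ 2)
      (2 * inner ℝ (x + r • e) e) r := fun e r => by
    have h := ((hasDerivAt_id r).smul_const e).const_add x
    simpa using h.norm_sq
  have hcd : ContDiff ℝ 2 (coleHopf s f) := (hf.contDiff_coleHopf hs).of_le (by norm_cast)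
  have hone : ∀ i, ‖b i‖ = 1 := b.orthonormal.1
  have hfirst : ∀ i r, HasDerivAt (fun r : ℝ => coleHopf s f (x + r • b i))
      (inner ℝ (x + r • b i) (b i) / s
        - s⁻¹ * Λ (fun z => inner ℝ z (b i)) (x + r • b i) / Λ (fun _ => 1) (x + r • b i)) r :=
    fun i r => by
      have h := (((hnorm (b i) r).div_const (2 * s)).const_add
        (Module.finrank ℝ E / 2 * Real.log (2 * Real.pi * s))).sub
        ((hΛ1 (b i) r).log (h1pos _).ne')
      refine (h.congr_of_eventuallyEq
        (Eventually.of_forall fun r => coleHopf_eq hf hs _)).congr_deriv ?_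
      simp only [mul_div_mul_left _ _ (two_ne_zero (α := ℝ)), hΛ]
  have hgrad := norm_gradient_sq_of_lines b (hcd.differentiable (by norm_num)) x
    fun i => hfirst i 0
  have hlap := laplacian_of_lines b hcd x
    (f₂ := fun i => 1 / s - s⁻¹ ^ 2 * (Λ (fun z => (inner ℝ z (b i)) ^ 2) x / Λ (fun _ => 1) x
      - (Λ (fun z => inner ℝ z (b i)) x / Λ (fun _ => 1) x) ^ 2))
    hfirst
    (fun i => by
      have h0 : HasDerivAt (fun r : ℝ => (inner ℝ (x + r • b i) (b i) : ℝ)) 1 0 := by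
        have h := (((hasDerivAt_id (0 : ℝ)).smul_const (b i)).const_add x).inner ℝ
          (hasDerivAt_const (0 : ℝ) (b i))
        simpa [hone i] using h
      have h := (h0.div_const s).sub
        (((hΛ2 (b i) 0).const_mul s⁻¹).div (hΛ1 (b i) 0) (h1pos _).ne')
      refine h.congr_deriv ?_
      simp only [zero_smul, add_zero]
      have := (h1pos x).ne'
      field_simp)
  have htime : HasDerivAt (fun r : ℝ => gaussianLaplace f (fun _ => 1) (r⁻¹ • x, (2 * r)⁻¹))
      (-(s⁻¹ ^ 2) * Λ (fun z => inner ℝ z x) x + s⁻¹ ^ 2 / 2 * Λ (fun z => ‖z‖ ^ 2) x) s := by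
    have hc : HasDerivAt (fun r : ℝ => (r⁻¹ • x, (2 * r)⁻¹))
        ((-(s⁻¹ ^ 2) • x, -(s⁻¹ ^ 2 / 2)) : E × ℝ) s := by
      have h1 := (hasDerivAt_inv hs.ne').smul_const x
      have h2 := ((hasDerivAt_id s).const_mul 2).inv (by simpa using hs.ne')
      refine (h1.prodMk h2).congr_deriv ?_
      rw [inv_pow]
      congr 1
      simp only [id]
      field_simp
    refine (hL1.hasDerivAt hT hc (hpt x)).congr_deriv ?_
    have hx := (hLe x).integrable hT (hpt x)
    simp only [hΛ, gaussianLaplace, laplaceTransform]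
    rw [← integral_const_mul, ← integral_const_mul,
      ← integral_add (hx.const_mul _) (hsq.const_mul _)]
    congr 1; ext z
    simp [inner_smul_right]
    ring
  have hmain : HasDerivAt (fun r => coleHopf r f x)
      (Module.finrank ℝ E / 2 * (1 / s) - ‖x‖ ^ 2 / 2 * s⁻¹ ^ 2
        - (-(s⁻¹ ^ 2) * Λ (fun z => inner ℝ z x) x + s⁻¹ ^ 2 / 2 * Λ (fun z => ‖z‖ ^ 2) x)
          / Λ (fun _ => 1) x) s := by
    have h1 : HasDerivAt (fun r : ℝ => Module.finrank ℝ E / 2 * Real.log (2 * Real.pi * r))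
        (Module.finrank ℝ E / 2 * (1 / s)) s := by
      have h := (((hasDerivAt_id s).const_mul (2 * Real.pi)).log
        (by simp [hs.ne', Real.pi_ne_zero])).const_mul (Module.finrank ℝ E / 2 : ℝ)
      refine h.congr_deriv ?_
      have := Real.pi_ne_zero
      simp only [id]
      field_simp
    have h2 : HasDerivAt (fun r : ℝ => ‖x‖ ^ 2 / (2 * r)) (-(‖x‖ ^ 2 / 2 * s⁻¹ ^ 2)) s := by
      have h := (hasDerivAt_inv hs.ne').const_mul (‖x‖ ^ 2 / 2)
      refine (h.congr_of_eventuallyEq (Eventually.of_forall fun r => ?_)).congr_deriv ?_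
      · simp only [div_eq_mul_inv, mul_inv, mul_assoc]
      · rw [inv_pow]; ring
    have h := (h1.add h2).sub (htime.log (h1pos x).ne')
    refine (h.congr_of_eventuallyEq ?_).congr_deriv (by ring)
    filter_upwards [lt_mem_nhds hs] with r hr
    exact coleHopf_eq hf hr x
  refine hmain.congr_deriv ?_
  -- Write both sides as sums over the basis; they agree term by term.
  have hS2 : ∑ i, Λ (fun z => (inner ℝ z (b i)) ^ 2) x = Λ (fun z => ‖z‖ ^ 2) x := by
    simp only [hΛ, gaussianLaplace, laplaceTransform]
    rw [← integral_finsetSum _ fun i _ => hLee (b i)]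
    congr 1; ext z
    rw [← Finset.smul_sum, ← Finset.sum_mul, b.sum_sq_inner_left]
  have hSx : ∑ i, inner ℝ x (b i) * Λ (fun z => inner ℝ z (b i)) x
      = Λ (fun z => inner ℝ z x) x := by
    simp only [hΛ, gaussianLaplace, laplaceTransform, ← integral_const_mul]
    rw [← integral_finsetSum _ fun i _ => ((hLe (b i)).integrable hT (hpt x)).const_mul _]
    congr 1; ext z
    rw [← b.sum_inner_mul_inner z x, Finset.sum_mul, Finset.smul_sum]
    refine Finset.sum_congr rfl fun i _ => ?_
    rw [real_inner_comm x (b i), smul_eq_mul, smul_eq_mul]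
    ring
  have hSn : ∑ i, (inner ℝ x (b i) : ℝ) ^ 2 = ‖x‖ ^ 2 := b.sum_sq_inner_left x
  rw [hlap, hgrad, ← hS2, ← hSx, ← hSn]
  simp only [zero_smul, add_zero]
  have hcard : (Module.finrank ℝ E / 2 * (1 / s) : ℝ)
      = ∑ _i : Fin (Module.finrank ℝ E), 1 / 2 * (1 / s) := by
    simp; ring
  rw [hcard]
  have hne := (h1pos x).ne'
  simp only [Finset.mul_sum, Finset.sum_div, Finset.sum_mul, ← Finset.sum_add_distrib,
    ← Finset.sum_sub_distrib]
  refine Finset.sum_congr rfl fun i _ => ?_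
  field_simp
  ring

end Equation

/-! ### Convergence of the splitting scheme -/

section Convergence

variable {E : Type*} [NormedAddCommGroup E] [InnerProductSpace ℝ E] [FiniteDimensional ℝ E]

/-- Semiconcavity provides the quadratic upper bound. -/
theorem QuadConvex.of_convexOn_of_concaveOn {f : E → ℝ} (hf : ConvexOn ℝ univ f) {k : ℝ}
    (hk : ConcaveOn ℝ univ fun x => f x - k / 2 * ‖x‖ ^ 2) : QuadConvex f := by
  obtain ⟨A, B, hB, h⟩ := hk.neg.exists_neg_norm_le
  refine ⟨hf, A + B, B + |k| / 2, by positivity, fun x => ?_⟩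
  have h1 := h x
  simp only [Pi.neg_apply] at h1
  have h2 : k / 2 * ‖x‖ ^ 2 ≤ |k| / 2 * ‖x‖ ^ 2 := by gcongr; exact le_abs_self k
  nlinarith [mul_nonneg hB (sq_nonneg (‖x‖ - 1)), mul_nonneg hB (sq_nonneg ‖x‖), norm_nonneg x,
    mul_nonneg hB (norm_nonneg x)]

variable [MeasurableSpace E] [BorelSpace E]

/-- Continuity up to `s = 0`, by writing the Gaussian average as an average over `√s` times a
standard Gaussian variable. -/
theorem QuadConvex.continuousOn_coleHopf {f : E → ℝ} (hf : QuadConvex f) (x : E) :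
    ContinuousOn (fun s => coleHopf s f x) (Ici 0) := by
  have hx := hf.comp_add_left x
  obtain ⟨A, B, hB, h⟩ := hx.exists_neg_norm_le
  have hc := hx.continuous
  have hcont : Continuous fun r : ℝ => ∫ y, Real.exp (-f (x + r • y)) ∂(heatMeasure E 1) := by
    refine continuous_iff_continuousAt.mpr fun r₀ => ?_
    refine continuousAt_of_dominated
      (bound := fun y => Real.exp A * Real.exp (B * (|r₀| + 1) * ‖y‖)) ?_ ?_ ?_ ?_
    · refine Eventually.of_forall fun r => (Continuous.aestronglyMeasurable ?_)
      exact Real.continuous_exp.comp (hc.comp (by fun_prop : Continuous fun y : E => r • y)).neg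
    · filter_upwards [Metric.ball_mem_nhds r₀ one_pos] with r hr
      refine Eventually.of_forall fun y => ?_
      rw [Real.norm_of_nonneg (Real.exp_pos _).le, ← Real.exp_add, Real.exp_le_exp]
      have h1 := h (r • y)
      have h2 : |r| ≤ |r₀| + 1 := by
        rw [Metric.mem_ball, Real.dist_eq] at hr
        have := abs_sub_abs_le_abs_sub r r₀
        linarith
      rw [norm_smul, Real.norm_eq_abs] at h1
      have h3 : B * (|r| * ‖y‖) ≤ B * ((|r₀| + 1) * ‖y‖) := by gcongr
      linarith
    · exact (integrable_exp_norm_heatMeasure zero_le_one _).const_mul _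
    · refine Eventually.of_forall fun y => Continuous.continuousAt ?_
      exact Real.continuous_exp.comp (hc.comp (by fun_prop : Continuous fun r : ℝ => r • y)).neg
  have heq : ∀ s ∈ Ici (0 : ℝ), heatOp s (fun z => Real.exp (-f z)) x
      = ∫ y, Real.exp (-f (x + √s • y)) ∂(heatMeasure E 1) := fun s hs => by
    rw [heatOp, heatMeasure_eq_map hs, integral_map (by fun_prop)]
    exact (Real.continuous_exp.comp hc.neg).aestronglyMeasurable
  refine ContinuousOn.neg (ContinuousOn.log ?_ fun s hs => (hf.heatOp_exp_neg_pos hs x).ne')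
  exact (hcont.comp Real.continuous_sqrt).continuousOn.congr heq

/-- The splitting scheme is squeezed between the values of the Cole–Hopf semigroup at `n s` and
at `(n + 1) s`. -/
theorem QuadConvex.tendsto_splitOp {f : E → ℝ} (hf : QuadConvex f) {k : ℝ}
    (hk : ConcaveOn ℝ univ fun x => f x - k / 2 * ‖x‖ ^ 2) {t : ℝ} (ht : 0 ≤ t) {s : ℕ → ℝ}
    (hs : ∀ i, 0 < s i) (hs0 : Tendsto s atTop (𝓝 0)) {n : ℕ → ℕ}
    (hn : ∀ᶠ i in atTop, n i * s i = t) (x : E) :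
    Tendsto (fun i => splitOp (s i) (n i) f x) atTop (𝓝 (coleHopf t f x)) := by
  have hlow : Tendsto (fun i => coleHopf (t + s i) f x - k / 2 * gaussianMoment E * s i) atTop
      (𝓝 (coleHopf t f x - k / 2 * gaussianMoment E * 0)) := by
    refine Tendsto.sub ?_ (hs0.const_mul _)
    refine (hf.continuousOn_coleHopf x t ht).tendsto.comp (tendsto_nhdsWithin_iff.mpr ⟨?_, ?_⟩)
    · simpa using hs0.const_add t
    · exact Eventually.of_forall fun i => add_nonneg ht (hs i).le
  rw [mul_zero, sub_zero] at hlow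
  refine tendsto_of_tendsto_of_tendsto_of_le_of_le' hlow tendsto_const_nhds ?_ ?_
  · filter_upwards [hn] with i hi
    have := hf.coleHopf_le_splitOp hk (hs i) (n i) x
    rw [add_one_mul, hi] at this
    linarith
  · filter_upwards [hn] with i hi
    simpa only [hi] using hf.splitOp_le (hs i) (n i) x

end Convergence

/-! ### Rescaling -/

theorem gradient_const_mul {E : Type*} [NormedAddCommGroup E] [InnerProductSpace ℝ E]
    [CompleteSpace E] {f : E → ℝ} {x : E} (hf : DifferentiableAt ℝ f x) (r : ℝ) :
    gradient (fun y => r * f y) x = r • gradient f x := by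
  rw [gradient, gradient, fderiv_const_mul hf, map_smul]

/-- The equation of the Cole–Hopf semigroup after rescaling the function by `ν⁻²` and the time by
`ν⁻¹`. -/
theorem QuadConvex.hasDerivAt_rescaled_coleHopf {E : Type} [NormedAddCommGroup E]
    [InnerProductSpace ℝ E] [FiniteDimensional ℝ E] [MeasurableSpace E] [BorelSpace E]
    {f : E → ℝ} (hf : QuadConvex f) {ν : ℝ} (hν : 0 < ν) {t : ℝ} (ht : 0 < t) (x : E) :
    HasDerivAt (fun r => (ν ^ 2)⁻¹ * coleHopf (r / ν) f x)
      (1 / (2 * ν) * Laplacian.laplacian (fun y => (ν ^ 2)⁻¹ * coleHopf (t / ν) f y) x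
        - 1 / 2 * (‖ν • gradient (fun y => (ν ^ 2)⁻¹ * coleHopf (t / ν) f y) x‖ ^ 2 / ν)) t := by
  have hs : 0 < t / ν := div_pos ht hν
  have hcd : ContDiff ℝ 2 (coleHopf (t / ν) f) := (hf.contDiff_coleHopf hs).of_le (by norm_cast)
  have hlap : Laplacian.laplacian (fun y => (ν ^ 2)⁻¹ * coleHopf (t / ν) f y) x
      = (ν ^ 2)⁻¹ * Laplacian.laplacian (coleHopf (t / ν) f) x := by
    have h := InnerProductSpace.laplacian_smul (ν ^ 2)⁻¹ (hcd.contDiffAt (x := x))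
    simp only [smul_eq_mul] at h
    exact h
  have h := ((hf.hasDerivAt_coleHopf hs x).comp t ((hasDerivAt_id t).div_const ν)).const_mul
    (ν ^ 2)⁻¹
  refine h.congr_deriv ?_
  rw [hlap, gradient_const_mul (hcd.differentiable (by norm_num) x), smul_smul, norm_smul,
    mul_pow, Real.norm_eq_abs, sq_abs]
  field_simp

/-! ### Tuples of self-adjoint matrices -/

section Matrices

variable {m N : ℕ}

theorem sum_trace_sq_eq (x : MatTuple m N) :
    ∑ j, (Matrix.trace (x.coord j ^ 2)).re = ‖x‖ ^ 2 := by
  rw [← real_inner_self_eq_norm_sq]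
  simp only [sq]
  rfl

theorem normTwoSq_eq (x : MatTuple m N) : normTwoSq x = ‖x‖ ^ 2 / N := by
  rw [normTwoSq, ← Finset.mul_sum, sum_trace_sq_eq]
  ring

theorem gueLaw_eq (hN : 1 ≤ N) (t : ℝ) : gueLaw m N t = heatMeasure (MatTuple m N) (t / N) := by
  have hN' : (N : ℝ) ≠ 0 := by positivity
  have hw : (gueWeight t : MatTuple m N → ℝ≥0∞)
      = fun x => ENNReal.ofReal (gaussianWeight (t / N) x) := by
    funext x
    rw [gueWeight, gaussianWeight, ← Finset.sum_div, sum_trace_sq_eq]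
    congr 3
    rw [mul_div_assoc', mul_div_assoc', div_div_eq_mul_div, mul_comm (N : ℝ)]
  have h0 : t / N = 0 ↔ t = 0 := by simp [hN']
  simp only [gueLaw, heatMeasure, hw, h0]

theorem heatP_eq (hN : 1 ≤ N) (t : ℝ) (u : MatTuple m N → ℝ) : heatP t u = heatOp (t / N) u := by
  funext x
  rw [heatP, heatOp, gueLaw_eq hN]

theorem sq_mul_heatP (hN : 1 ≤ N) (t : ℝ) (u : MatTuple m N → ℝ) (x : MatTuple m N) :
    (N : ℝ) ^ 2 * heatP t u x = heatOp (t / N) (fun y => (N : ℝ) ^ 2 * u y) x := by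
  rw [heatP_eq hN, heatOp, heatOp, integral_const_mul]

theorem sq_mul_hopfLaxQ (hN : 1 ≤ N) {t : ℝ} (ht : 0 < t) (u : MatTuple m N → ℝ)
    (x : MatTuple m N) :
    (N : ℝ) ^ 2 * hopfLaxQ t u x = infConv (t / N) (fun y => (N : ℝ) ^ 2 * u y) x := by
  have hN' : (N : ℝ) ≠ 0 := by positivity
  rw [hopfLaxQ, if_neg ht.ne', Real.mul_iInf_of_nonneg (by positivity), infConv]
  congr 1; ext y
  rw [normTwoSq_eq]
  field_simp

theorem sq_mul_splitting (hN : 1 ≤ N) (l n : ℕ) (u : MatTuple m N → ℝ) (x : MatTuple m N) :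
    (N : ℝ) ^ 2 * splitting l n u x
      = splitOp ((1 / 2 : ℝ) ^ l / N) n (fun y => (N : ℝ) ^ 2 * u y) x := by
  induction n generalizing x with
  | zero => rfl
  | succ n ih =>
    have e : splitting l (n + 1) u
        = heatP ((1 / 2 : ℝ) ^ l) (hopfLaxQ ((1 / 2 : ℝ) ^ l) (splitting l n u)) :=
      Function.iterate_succ_apply' _ _ _
    rw [e, splitOp_succ, sq_mul_heatP hN]
    congr 1; ext y
    rw [sq_mul_hopfLaxQ hN (by positivity)]
    congr 1; ext z
    exact ih z

theorem neBot_nhdsWithin_dyadics {t : ℝ} (ht : 0 ≤ t) : (𝓝[dyadics] t).NeBot := by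
  rw [← mem_closure_iff_nhdsWithin_neBot]
  have h2 : Tendsto (fun n : ℕ => (2 : ℝ) ^ n) atTop atTop :=
    tendsto_pow_atTop_atTop_of_one_lt one_lt_two
  refine mem_closure_of_tendsto ((tendsto_nat_floor_mul_div_atTop ht).comp h2)
    (Eventually.of_forall fun n => ⟨n, ⌊t * 2 ^ n⌋₊, ?_⟩)
  simp [div_eq_mul_inv]

theorem eventually_floor_mul_eq {t : ℝ} (ht : t ∈ dyadics) :
    ∀ᶠ l : ℕ in atTop, (⌊2 ^ l * t⌋₊ : ℝ) * (1 / 2 : ℝ) ^ l = t := by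
  obtain ⟨n, k, rfl⟩ := ht
  filter_upwards [eventually_ge_atTop n] with l hl
  obtain ⟨d, rfl⟩ := Nat.exists_eq_add_of_le hl
  have h : (2 : ℝ) ^ (n + d) * (k * (1 / 2 : ℝ) ^ n) = ((2 ^ d * k : ℕ) : ℝ) := by
    push_cast
    rw [pow_add, one_div, inv_pow]
    field_simp
  rw [h, Nat.floor_natCast]
  push_cast
  rw [pow_add, one_div, inv_pow, inv_pow]
  field_simp

theorem nonneg_of_mem_dyadics {t : ℝ} (ht : t ∈ dyadics) : 0 ≤ t := by
  obtain ⟨n, k, rfl⟩ := ht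
  positivity

/-- The Cole–Hopf solution in the normalization of the matrix model, where `N² u` and `t / N`
take the places of the function and of the time. -/
def matrixColeHopf (t : ℝ) (u : MatTuple m N → ℝ) (x : MatTuple m N) : ℝ :=
  ((N : ℝ) ^ 2)⁻¹ * coleHopf (t / N) (fun y => (N : ℝ) ^ 2 * u y) x

variable {c C : ℝ} {u : MatTuple m N → ℝ}

theorem concaveOn_of_mem_classE (hN : 1 ≤ N) (hu : u ∈ classE m N c C) :
    ConcaveOn ℝ univ fun x => (N : ℝ) ^ 2 * u x - (N * C) / 2 * ‖x‖ ^ 2 := by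
  have hN' : (N : ℝ) ≠ 0 := by positivity
  refine (hu.2.smul (by positivity : (0 : ℝ) ≤ (N : ℝ) ^ 2)).congr fun x _ => ?_
  simp only [normTwoSq_eq, smul_eq_mul]
  field_simp

theorem quadConvex_of_mem_classE (hN : 1 ≤ N) (hc : 0 ≤ c) (hu : u ∈ classE m N c C) :
    QuadConvex fun x => (N : ℝ) ^ 2 * u x := by
  refine QuadConvex.of_convexOn_of_concaveOn ?_ (concaveOn_of_mem_classE hN hu)
  have hN' : (N : ℝ) ≠ 0 := by positivity
  have h1 := hu.1.smul (by positivity : (0 : ℝ) ≤ (N : ℝ) ^ 2)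
  have h2 := (convexOn_norm_sq (E := MatTuple m N)).smul (by positivity : 0 ≤ N * c / 2)
  refine (h1.add h2).congr fun x _ => ?_
  simp only [normTwoSq_eq, smul_eq_mul, Pi.add_apply]
  field_simp
  ring

theorem tendsto_splitting (hN : 1 ≤ N) (hc : 0 ≤ c) (hu : u ∈ classE m N c C) {t : ℝ}
    (ht : t ∈ dyadics) (x : MatTuple m N) :
    Tendsto (fun l : ℕ => splitting l ⌊2 ^ l * t⌋₊ u x) atTop (𝓝 (matrixColeHopf t u x)) := by
  have hN' : (0 : ℝ) < N := by positivity
  have hs0 : Tendsto (fun l : ℕ => (1 / 2 : ℝ) ^ l / N) atTop (𝓝 0) := by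
    simpa using (tendsto_pow_atTop_nhds_zero_of_lt_one (by norm_num : (0 : ℝ) ≤ 1 / 2)
      (by norm_num)).div_const (N : ℝ)
  have h := (quadConvex_of_mem_classE hN hc hu).tendsto_splitOp (concaveOn_of_mem_classE hN hu)
    (div_nonneg (nonneg_of_mem_dyadics ht) hN'.le) (s := fun l => (1 / 2 : ℝ) ^ l / N)
    (fun l => by positivity) hs0 (n := fun l => ⌊2 ^ l * t⌋₊)
    ((eventually_floor_mul_eq ht).mono fun l hl => by rw [mul_div_assoc', hl]) x
  refine (h.const_mul ((N : ℝ) ^ 2)⁻¹).congr fun l => ?_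
  rw [← sq_mul_splitting hN, inv_mul_cancel_left₀ (by positivity)]

theorem tendsto_dyadicR (hN : 1 ≤ N) (hc : 0 ≤ c) (hu : u ∈ classE m N c C) {t : ℝ}
    (ht : 0 ≤ t) (x : MatTuple m N) :
    Tendsto (fun s => dyadicR s u x) (𝓝[dyadics] t) (𝓝 (matrixColeHopf t u x)) := by
  have hN' : (0 : ℝ) < N := by positivity
  have hcont : ContinuousOn (fun s : ℝ => matrixColeHopf s u x) (Ici 0) := by
    refine continuousOn_const.mul
      (((quadConvex_of_mem_classE hN hc hu).continuousOn_coleHopf x).comp (by fun_prop)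
        fun s hs => div_nonneg hs hN'.le)
  have h := ((hcont t ht).mono fun s hs => nonneg_of_mem_dyadics hs).tendsto
  refine h.congr' ?_
  filter_upwards [self_mem_nhdsWithin] with s hs
  exact (tendsto_splitting hN hc hu hs x).limUnder_eq.symm

theorem semigroupR_eq (hN : 1 ≤ N) (hc : 0 ≤ c) (hu : u ∈ classE m N c C) {t : ℝ}
    (ht : 0 ≤ t) : semigroupR t u = matrixColeHopf t u := by
  have := neBot_nhdsWithin_dyadics ht
  exact funext fun x => (tendsto_dyadicR hN hc hu ht x).limUnder_eq

theorem contDiffOn_semigroupR (hN : 1 ≤ N) (hc : 0 ≤ c) (hu : u ∈ classE m N c C) :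
    ContDiffOn ℝ (⊤ : ℕ∞) (fun p : MatTuple m N × ℝ => semigroupR p.2 u p.1)
      (univ ×ˢ Ioi 0) := by
  have hN' : (0 : ℝ) < N := by positivity
  have h : ContDiffOn ℝ (⊤ : ℕ∞) (fun p : MatTuple m N × ℝ => matrixColeHopf p.2 u p.1)
      (univ ×ˢ Ioi 0) := by
    refine contDiffOn_const.mul ((quadConvex_of_mem_classE hN hc hu).contDiffOn_coleHopf.comp
      (f := fun p : MatTuple m N × ℝ => (p.1, p.2 / N)) (by fun_prop) fun p hp => ?_)
    exact ⟨mem_univ _, div_pos hp.2 hN'⟩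
  exact h.congr fun p hp => congrFun (semigroupR_eq hN hc hu (le_of_lt hp.2)) p.1

theorem hasDerivAt_semigroupR (hN : 1 ≤ N) (hc : 0 ≤ c) (hu : u ∈ classE m N c C)
    (x : MatTuple m N) {t : ℝ} (ht : 0 < t) :
    HasDerivAt (fun s : ℝ => semigroupR s u x)
      (1 / (2 * (N : ℝ)) * Laplacian.laplacian (semigroupR t u) x
        - 1 / 2 * normTwoSq (normGrad (semigroupR t u) x)) t := by
  have hN' : (0 : ℝ) < N := by positivity
  have h := (quadConvex_of_mem_classE hN hc hu).hasDerivAt_rescaled_coleHopf hN' ht x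
  rw [semigroupR_eq hN hc hu ht.le, normTwoSq_eq, normGrad]
  refine h.congr_of_eventuallyEq ?_
  filter_upwards [lt_mem_nhds ht] with s hs
  exact congrFun (semigroupR_eq hN hc hu hs.le) x

theorem exp_semigroupR (hN : 1 ≤ N) (hc : 0 ≤ c) (hu : u ∈ classE m N c C) {t : ℝ} (ht : 0 ≤ t)
    (x : MatTuple m N) :
    Integrable (fun y => Real.exp (-(N : ℝ) ^ 2 * u (x + y))) (gueLaw m N t) ∧
      Real.exp (-(N : ℝ) ^ 2 * semigroupR t u x)
        = heatP t (fun z => Real.exp (-(N : ℝ) ^ 2 * u z)) x := by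
  have hN' : (0 : ℝ) < N := by positivity
  have hq := quadConvex_of_mem_classE hN hc hu
  have hs : 0 ≤ t / N := div_nonneg ht hN'.le
  have h := hq.exp_neg_coleHopf hs x
  have hi := (hq.comp_add_left x).integrable_exp_neg hs
  simp only [neg_mul]
  refine ⟨by rw [gueLaw_eq hN]; exact hi, ?_⟩
  rw [heatP_eq hN, semigroupR_eq hN hc hu ht, matrixColeHopf, mul_inv_cancel_left₀ (by positivity)]
  exact h

end Matrices

end HeatHJ

end

theorem mainTheorem4 (m N : ℕ) (hN : 1 ≤ N) (c C : ℝ) (hc : 0 ≤ c) (hcC : c ≤ C)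
    (u₀ : HeatHJ.MatTuple m N → ℝ) (hu₀ : u₀ ∈ HeatHJ.classE m N c C) :
    -- the limits that define `R_t u₀` exist
    (∀ t ∈ HeatHJ.dyadics, ∀ x, Filter.Tendsto
      (fun ℓ : ℕ => HeatHJ.splitting ℓ ⌊2 ^ ℓ * t⌋₊ u₀ x) Filter.atTop
      (nhds (HeatHJ.semigroupR t u₀ x))) ∧
    (∀ t : ℝ, 0 ≤ t → ∀ x, Filter.Tendsto (fun s : ℝ => HeatHJ.dyadicR s u₀ x)
      (nhdsWithin t HeatHJ.dyadics) (nhds (HeatHJ.semigroupR t u₀ x))) ∧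
    -- `u(x, t) = R_t u₀ (x)` is smooth for `t > 0`
    ContDiffOn ℝ (⊤ : ℕ∞)
      (fun p : HeatHJ.MatTuple m N × ℝ => HeatHJ.semigroupR p.2 u₀ p.1)
      (Set.univ ×ˢ Set.Ioi 0) ∧
    -- `∂_t u = (1/2N) Δ u - (1/2) ‖D u‖₂²`
    (∀ x, ∀ t : ℝ, 0 < t → HasDerivAt (fun s : ℝ => HeatHJ.semigroupR s u₀ x)
      (1 / (2 * (N : ℝ)) * Laplacian.laplacian (HeatHJ.semigroupR t u₀) x
        - 1 / 2 * HeatHJ.normTwoSq (HeatHJ.normGrad (HeatHJ.semigroupR t u₀) x)) t) ∧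
    -- `exp(-N² R_t u₀) = P_t [exp(-N² u₀)]`, the integral being convergent
    (∀ t : ℝ, 0 ≤ t → ∀ x,
      MeasureTheory.Integrable (fun y => Real.exp (-(N : ℝ) ^ 2 * u₀ (x + y)))
        (HeatHJ.gueLaw m N t) ∧
      Real.exp (-(N : ℝ) ^ 2 * HeatHJ.semigroupR t u₀ x)
        = HeatHJ.heatP t (fun z => Real.exp (-(N : ℝ) ^ 2 * u₀ z)) x) := by
  have h : ∀ t : ℝ, 0 ≤ t → HeatHJ.semigroupR t u₀ = HeatHJ.matrixColeHopf t u₀ :=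
    fun t ht => HeatHJ.semigroupR_eq hN hc hu₀ ht
  refine ⟨fun t ht x => ?_, fun t ht x => ?_, HeatHJ.contDiffOn_semigroupR hN hc hu₀,
    fun x t ht => HeatHJ.hasDerivAt_semigroupR hN hc hu₀ x ht,
    fun t ht x => HeatHJ.exp_semigroupR hN hc hu₀ ht x⟩
  · rw [h t (HeatHJ.nonneg_of_mem_dyadics ht)]
    exact HeatHJ.tendsto_splitting hN hc hu₀ ht x
  · rw [h t ht]
    exact HeatHJ.tendsto_dyadicR hN hc hu₀ ht x
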